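/- **Setting.** Let $\Sigma=\{0,1\}^k$ be an alphabet of bit strings, $c\ge 1$, $d\ge 0$, and let $\mathcal R=\{0,1\}^l$ be the range of hash values; $\oplus$ is bitwise exclusive or. A simple tabulation hash function on $\Sigma^m$ is $y\mapsto T_1[y_1]\oplus\dots\oplus T_m[y_m]$. A random tornado tabulation hash function $h:\Sigma^c\to\mathcal R$ is given by simple tabulation functions $\tilde h_0:\Sigma^{c-1}\to\Sigma$, $\tilde h_i:\Sigma^{c+i-1}\to\Sigma$ ($1\le i\le d$) and $\widehat h:\Sigma^{c+d}\to\mathcal R$, all of whose table entries are independent and uniform. The derived key $\tilde x\in\Sigma^{c+d}$ of $x\in\Sigma^c$ has $\tilde x_j=x_j$ for $j<c$, $\tilde x_c=x_c\oplus\tilde h_0(\tilde x_1\cdots\tilde x_{c-1})$ and $\tilde x_{c+i}=\tilde h_i(\tilde x_1\cdots\tilde x_{c+i-1})$ for $1\le i\le d$; and $h(x)=\widehat h(\tilde x)$. Let $\bar h:\Sigma^c\to\mathcal R\times\Sigma$ map $x$ to the pair consisting of the exclusive or of the first $c+d-1$ table lookups of $\widehat h$ on $\tilde x$, and of the last character $\tilde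 x_{c+d}$; thus $h(x)=\bar h[0](x)\oplus\widehat h_{c+d}(\bar h[1](x))$, where $\widehat h_{c+d}$ is the last table of $\widehat h$. Let $A\subseteq\Sigma^c$ be a set of keys and let $s$ of the $l$ bit positions of hash values be designated as selection bits. A key $x\in A$ is selected if the selection bits of $h(x)$ match a given bitmask (which may depend on $x$, but not on $h$), so that the expected number of selected keys is $\mu=|A|/2^s$. Let $X$ be the set of selected keys, $X_\alpha=\{x\in X:\tilde x_{c+d}=\alpha\}$ for $\alpha\in\Sigma$, and $S_i=|\{\alpha\in\Sigma: |X_\alpha|\ge i\}|$. **Lemma.** Assume $\mu\le|\Sigma|/2$ and $s\le|\Sigma|/2$, and let $i_{\max}=\ln\left(|\Sigma|^{d-2}2^s\right)$. Then, summing over all integers $i\ge 0$ with $i>i_{\max}$ (the series converges for every outcome of the tables, since $S_i=0$ for $i>|A|$), $$\Pr\Big[\sum_{i>i_{\max}}\mathrm{E}\big[S_i\mid\bar h\big]>0\Big]\le\Big(\frac1{|\Sigma|}\Big)^{d-3}+3^{c+1}\Big(\frac3{|\Sigma|}\Big)^{d-1}+\Big(\frac1{|\Sigma|}\Big)^{|\Sigma|/2-1}.$$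 -/

import Mathlib

open MeasureTheory ProbabilityTheory

namespace Tornado

/-- Bit strings of length `k`. Addition is bitwise exclusive or. -/
abbrev Bits (k : ℕ) : Type := Fin k → ZMod 2

/-- Keys: `c` characters from the alphabet of `k`-bit strings (positions are counted from `0`). -/
abbrev Key (c k : ℕ) : Type := Fin c → Bits k

/-- Simple tabulation hashing: the exclusive or of one table lookup for each character. -/
def simpleTab {m k r : ℕ} (T : Fin m → Bits k → Bits r) (y : Fin m → Bits k) : Bits r :=
  ∑ j, T j (y j)

/-- All lookup tables of a tornado tabulation hash function with `c` input characters,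
`d` derived characters, alphabet of `k`-bit strings and `l`-bit hash values. -/
@[ext]
structure Tables (c d k l : ℕ) where
  /-- the tables of the function that twists the last input character -/
  twist : Fin (c - 1) → Bits k → Bits k
  /-- the tables of the functions that compute the derived characters -/
  derive : (i : Fin d) → Fin (c + i) → Bits k → Bits k
  /-- the tables of the top simple tabulation function -/
  top : Fin (c + d) → Bits k → Bits l

instance (c d k l : ℕ) : Finite (Tables c d k l) :=
  Finite.of_injective
    (fun T : Tables c d k l => (T.twist, T.derive, T.top))
    (fun T T' h => by
      simp only [Prod.mk.injEq] at h
      exact Tables.ext h.1 h.2.1 h.2.2)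

instance (c d k l : ℕ) : Nonempty (Tables c d k l) := ⟨⟨0, 0, 0⟩⟩

instance (c d k l : ℕ) : MeasurableSpace (Tables c d k l) := ⊤

instance (c d k l : ℕ) : DiscreteMeasurableSpace (Tables c d k l) := ⟨fun _ => trivial⟩

/-- All table entries are independent and uniformly random. -/
noncomputable def law (c d k l : ℕ) : Measure (Tables c d k l) := uniformOn Set.univ

instance (c d k l : ℕ) : IsProbabilityMeasure (law c d k l) :=
  isProbabilityMeasure_uniformOn Set.finite_univ Set.univ_nonempty

variable {c d k l : ℕ}

/-- The first `c` characters of the derived key: the key itself, except that the last character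
is twisted by a simple tabulation hash of the other ones. -/
def twisted (T : Tables c d k l) (x : Key c k) : Key c k := fun j =>
  if (j : ℕ) + 1 < c then x j
  else x j + simpleTab T.twist (fun i => x (Fin.castLE (Nat.sub_le c 1) i))

/-- The first `c + i` characters of the derived key. -/
def derivedPrefix (T : Tables c d k l) (x : Key c k) :
    (i : ℕ) → i ≤ d → (Fin (c + i) → Bits k)
  | 0, _ => twisted T x
  | i + 1, h =>
      Fin.snoc (α := fun _ => Bits k) (derivedPrefix T x i (Nat.le_of_succ_le h))
        (simpleTab (T.derive ⟨i, h⟩) (derivedPrefix T x i (Nat.le_of_succ_le h)))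

/-- The derived key, of `c + d` characters. -/
def derivedKey (T : Tables c d k l) (x : Key c k) : Fin (c + d) → Bits k :=
  derivedPrefix T x d le_rfl

/-- The tornado tabulation hash function. -/
def hash (T : Tables c d k l) (x : Key c k) : Bits l := simpleTab T.top (derivedKey T x)

/-- The position of the last character of the derived key. -/
def lastPos (c d : ℕ) [NeZero c] : Fin (c + d) :=
  ⟨c + d - 1, by have := NeZero.pos c; omega⟩

/-- The part of the computation that precedes the last table lookup: the exclusive or of the
first `c + d - 1` lookups of the top function, and the last character of the derived key. -/
def hbar [NeZero c] (T : Tables c d k l) (x : Key c k) : Bits l × Bits k :=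
  (∑ j ∈ Finset.univ.erase (lastPos c d), T.top j (derivedKey T x j),
    derivedKey T x (lastPos c d))

theorem hash_eq_hbar [NeZero c] (T : Tables c d k l) (x : Key c k) :
    hash T x = (hbar T x).1 + T.top (lastPos c d) (hbar T x).2 := by
  simp only [hash, simpleTab, hbar]
  rw [Finset.sum_erase_add _ _ (Finset.mem_univ _)]

/-- The selected keys: the keys `x` of `A` whose hash value agrees with the bitmask `mask x` on
the selection bits, which are the bits at the positions in `sel`. -/
def selected (A : Finset (Key c k)) (sel : Finset (Fin l)) (mask : Key c k → Bits l)
    (T : Tables c d k l) : Finset (Key c k) :=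
  A.filter fun x => ∀ j ∈ sel, hash T x j = mask x j

/-- The bucket of `α`: the selected keys whose last derived character is `α`. -/
def bucket [NeZero c] (A : Finset (Key c k)) (sel : Finset (Fin l)) (mask : Key c k → Bits l)
    (T : Tables c d k l) (α : Bits k) : Finset (Key c k) :=
  (selected A sel mask T).filter fun x => derivedKey T x (lastPos c d) = α

/-- The size of layer `i`: the number of characters whose bucket has at least `i` keys. -/
def layer [NeZero c] (A : Finset (Key c k)) (sel : Finset (Fin l)) (mask : Key c k → Bits l)
    (i : ℕ) (T : Tables c d k l) : ℕ :=
  (Finset.univ.filter fun α : Bits k => i ≤ (bucket A sel mask T α).card).card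

/-- The conditional expectation of the size of layer `i` given the function `hbar`. -/
noncomputable def condLayer [NeZero c] (A : Finset (Key c k)) (sel : Finset (Fin l))
    (mask : Key c k → Bits l) (i : ℕ) : Tables c d k l → ℝ :=
  (law c d k l)[fun T => (layer A sel mask i T : ℝ) |
    MeasurableSpace.comap (fun (T : Tables c d k l) (x : Key c k) => hbar T x) ⊤]

/-- The size of the alphabet, as a real number. -/
noncomputable def alphabetSize (k : ℕ) : ℝ := (Fintype.card (Bits k) : ℝ)

/-- The threshold `ln (|Σ| ^ (d - 2) * 2 ^ s)`. -/
noncomputable def iMax (k d s : ℕ) : ℝ :=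
  Real.log (alphabetSize k ^ ((d : ℤ) - 2) * 2 ^ s)

end Tornado

/-! Write N = |Σ| and R = 2^s N, so |A| ≤ R/2. Once `hbar` is fixed, which keys with last character
α are selected depends only on the selection bits w of the last table at α; thus `hbar` splits A
into R bins (α, w). If the conditional expectation of layer i is positive, some tables with the same
`hbar` have a nonempty layer i, so a bin already holds i keys. It suffices to bound the probability
of a bin with more than i_max keys.

`hbar` is itself simple tabulation, applied to the derived key without its last character. Let V be
i + 1 keys in one bin. If V is independent, its values under `hbar` are independent and uniform, and
a union bound gives C(|A|, i+1) R^(-i) ≤ R / (2^(i+1) (i+1)!); the choice of i turns this into the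
first or the third term. Otherwise V contains a minimal zero set of some size 2t ≥ 4. Without one of
its keys it is independent, so it shares a bin with probability at most R^(-2(t-1)).

It remains to bound the expected number of minimal zero sets of size 2t after e = d - 1 derived
characters by 3^c (3/N)^e (3/4)^(t-1) R^(2(t-1)) (`sum_card_minZero_le`); the geometric series over
t then yields the second term. The induction on the number of derived characters starts from an
additive energy estimate (`card_isZero_le`). For one more character, a surviving set Z contains an
even set W that is almost independent, and W contains a minimal zero set L of the previous level;
charging Z to L gives the recursion `sum_card_minZero_appendChar_le`. -/

namespace Tornado

/-! ### Zero sets, independence, and simple tabulation on independent sets -/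

section ZeroSets

open Finset
open scoped Classical

variable {X ι σ : Type*} [DecidableEq σ]

/-- Every value of `q` is attained an even number of times on `S`. -/
def EvenOn (q : X → σ) (S : Finset X) : Prop := ∀ a, Even #{x ∈ S | q x = a}

/-- At every position, every character occurs an even number of times among the strings `p x`
with `x ∈ S`. -/
def IsZero (p : X → ι → σ) (S : Finset X) : Prop := ∀ j, EvenOn (fun x => p x j) S

/-- No nonempty subset of `V` is a zero set. -/
def Indep (p : X → ι → σ) (V : Finset X) : Prop := ∀ S ⊆ V, S.Nonempty → ¬ IsZero p S

/-- Minimal nonempty zero sets. -/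
def MinZero (p : X → ι → σ) (L : Finset X) : Prop :=
  L.Nonempty ∧ IsZero p L ∧ ∀ S ⊂ L, S.Nonempty → ¬ IsZero p S

theorem natCast_card_filter_eq_sum (q : X → σ) (S : Finset X) (a : σ) :
    ((#{x ∈ S | q x = a} : ℕ) : ZMod 2) =
      (∑ x ∈ S, Pi.single (q x) (1 : ZMod 2) : σ → ZMod 2) a := by
  rw [Finset.sum_apply, Finset.card_filter, Nat.cast_sum]
  refine Finset.sum_congr rfl fun x _ => ?_
  by_cases h : q x = a
  · subst h; simp
  · simp [h, Ne.symm h]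

theorem evenOn_iff_sum (q : X → σ) (S : Finset X) :
    EvenOn q S ↔ (∑ x ∈ S, Pi.single (q x) (1 : ZMod 2) : σ → ZMod 2) = 0 := by
  constructor
  · intro h
    funext a
    rw [← natCast_card_filter_eq_sum]
    exact (ZMod.natCast_eq_zero_iff_even).2 (h a)
  · intro h a
    rw [← ZMod.natCast_eq_zero_iff_even, natCast_card_filter_eq_sum, h]
    rfl

/-- The incidence vector of a string of characters. -/
def incidence (y : ι → σ) : ι → σ → ZMod 2 := fun j => Pi.single (y j) 1

theorem isZero_iff_sum (p : X → ι → σ) (S : Finset X) :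
    IsZero p S ↔ ∑ x ∈ S, incidence (p x) = 0 := by
  constructor
  · intro h
    funext j
    rw [Finset.sum_apply]
    exact (evenOn_iff_sum _ _).1 (h j)
  · intro h j
    rw [evenOn_iff_sum]
    have := congrFun h j
    rwa [Finset.sum_apply] at this

theorem EvenOn.even_card {q : X → σ} {S : Finset X} (h : EvenOn q S) : Even #S := by
  rw [Finset.card_eq_sum_card_image q S]
  exact Finset.even_sum _ fun a _ => h a

theorem EvenOn.exists_partner [DecidableEq X] {q : X → σ} {S : Finset X} (h : EvenOn q S)
    {x : X} (hx : x ∈ S) :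
    ∃ u ∈ S.erase x, q x = q u := by
  by_contra! hc
  have h1 : ({y ∈ S | q y = q x} : Finset X) = {x} := by
    ext y
    simp only [mem_filter, mem_singleton]
    constructor
    · rintro ⟨hy, hyx⟩
      by_contra hne
      exact hc y (mem_erase.2 ⟨hne, hy⟩) hyx.symm
    · rintro rfl
      exact ⟨hx, rfl⟩
  have := h (q x)
  rw [h1] at this
  simp at this

theorem EvenOn.erase_pair [DecidableEq X] {q : X → σ} {S : Finset X} (h : EvenOn q S)
    {u v : X} (hu : u ∈ S) (hv : v ∈ S) (huv : u ≠ v) (hq : q u = q v) : EvenOn q ((S.erase u).erase v) := by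
  rw [evenOn_iff_sum] at h ⊢
  rw [← Finset.add_sum_erase _ _ hu, ← Finset.add_sum_erase _ _ (mem_erase.2 ⟨huv.symm, hv⟩),
    ← add_assoc, hq, ZModModule.add_self, zero_add] at h
  exact h

theorem IsZero.even_card [Nonempty ι] {p : X → ι → σ} {S : Finset X} (h : IsZero p S) :
    Even #S := (h (Classical.arbitrary ι)).even_card

theorem exists_minZero_of_not_indep {p : X → ι → σ} {V : Finset X} (h : ¬ Indep p V) :
    ∃ L ⊆ V, MinZero p L := by
  simp only [Indep, not_forall, not_not] at h
  obtain ⟨S, hSV, hS, hz⟩ := h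
  obtain ⟨L, hL, hmin⟩ := Finset.exists_min_image
    (V.powerset.filter fun S => S.Nonempty ∧ IsZero p S) Finset.card
    ⟨S, by simp [hSV, hS, hz]⟩
  simp only [mem_filter, mem_powerset] at hL hmin
  refine ⟨L, hL.1, hL.2.1, hL.2.2, fun S' hS' hne hz' => ?_⟩
  exact absurd (Finset.card_lt_card hS')
    (not_lt.2 (hmin S' ⟨hS'.subset.trans hL.1, hne, hz'⟩))

theorem MinZero.indep_erase [DecidableEq X] {p : X → ι → σ} {L : Finset X} (h : MinZero p L)
    {x : X} (hx : x ∈ L) : Indep p (L.erase x) := fun S hS hne =>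
  h.2.2 S (hS.trans_ssubset (Finset.erase_ssubset hx)) hne

/-- The size is even, and two strings that form a zero set agree at every position, against
injectivity. -/
theorem MinZero.four_le_card [Nonempty ι] {p : X → ι → σ} (hp : Function.Injective p)
    {L : Finset X} (h : MinZero p L) : 4 ≤ #L := by
  have h0 : 0 < #L := h.1.card_pos
  have heven := h.2.1.even_card
  have h2 : #L ≠ 2 := by
    intro h2
    obtain ⟨x, y, hxy, rfl⟩ := Finset.card_eq_two.1 h2
    refine hxy (hp (funext fun j => ?_))
    obtain ⟨u, hu, hq⟩ := (h.2.1 j).exists_partner (mem_insert_self x {y})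
    have : u = y := by
      simp only [mem_erase, mem_insert, mem_singleton] at hu
      tauto
    rw [← this]; exact hq
  obtain ⟨r, hr⟩ := heven
  omega

/-- A nonempty set that is a zero set for `p` and on which `q` is even contains a dependent
set `W` on which `q` is even and that becomes independent when any pair of elements with equal
values of `q` is removed. -/
theorem exists_tight_dependent [DecidableEq X] {p : X → ι → σ} {q : X → σ} {Z : Finset X}
    (hne : Z.Nonempty) (hz : IsZero p Z) (hq : EvenOn q Z) :
    ∃ W ⊆ Z, ¬ Indep p W ∧ EvenOn q W ∧
      ∀ u ∈ W, ∀ v ∈ W, u ≠ v → q u = q v → Indep p ((W.erase u).erase v) := by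
  -- W has least cardinality. Removing a pair with equal `q` keeps `q` even, so a dependent
  -- remainder would be a smaller candidate.
  obtain ⟨W, hW, hmin⟩ := Finset.exists_min_image
    (Z.powerset.filter fun W => ¬ Indep p W ∧ EvenOn q W) Finset.card
    ⟨Z, by
      simp only [mem_filter, mem_powerset, Subset.refl, true_and]
      exact ⟨fun h => h Z (Subset.refl _) hne hz, hq⟩⟩
  simp only [mem_filter, mem_powerset] at hW hmin
  refine ⟨W, hW.1, hW.2.1, hW.2.2, fun u hu v hv huv huq => ?_⟩
  by_contra hc
  have hsub : (W.erase u).erase v ⊆ W := (erase_subset _ _).trans (erase_subset _ _)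
  have := hmin _ ⟨hsub.trans hW.1, hc, hW.2.2.erase_pair hu hv huv huq⟩
  have h1 := Finset.card_lt_card (Finset.erase_ssubset hu)
  have h2 := Finset.card_erase_le (s := W.erase u) (a := v)
  omega

/-- Over `ZMod 2` a linear relation is the sum over its support, which is then a zero set. -/
theorem Indep.linearIndependent {p : X → ι → σ} {V : Finset X} (h : Indep p V) :
    LinearIndependent (ZMod 2) fun x : V => incidence (p x) := by
  rw [Fintype.linearIndependent_iff]
  intro g hg
  by_contra! hc
  obtain ⟨i, hi⟩ := hc
  have h1 : ∀ z : ZMod 2, z ≠ 0 → z = 1 := by decide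
  set S : Finset X := (univ.filter fun x : V => g x ≠ 0).map (Function.Embedding.subtype _) with hS
  refine h S ?_ ⟨i, ?_⟩ ?_
  · intro x hx
    simp only [hS, mem_map, mem_filter, Function.Embedding.subtype_apply] at hx
    obtain ⟨y, -, rfl⟩ := hx
    exact y.2
  · exact mem_map.2 ⟨i, by simp [hi], rfl⟩
  · rw [isZero_iff_sum, hS, Finset.sum_map, Finset.sum_filter]
    refine (Finset.sum_congr rfl fun x _ => ?_).trans hg
    by_cases hx : g x = 0
    · rw [if_neg (not_not.2 hx), hx, zero_smul]
    · rw [if_pos hx, h1 _ hx, one_smul]; rfl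

variable [Fintype ι]

/-- Simple tabulation with values in an arbitrary commutative monoid. -/
def tabulate {M : Type*} [AddCommMonoid M] (g : ι → σ → M) (y : ι → σ) : M := ∑ j, g j (y j)

/-- Tabulation is a linear function of the incidence vector, and a linear map can be prescribed on
independent vectors and extended. -/
theorem Indep.exists_tabulate_eq {M : Type*} [AddCommGroup M] [Module (ZMod 2) M]
    {p : X → ι → σ} {V : Finset X} (h : Indep p V) (v : V → M) :
    ∃ g : ι → σ → M, ∀ x : V, tabulate g (p x) = v x := by
  have hli := h.linearIndependent
  obtain ⟨φ, hφ⟩ := LinearMap.exists_extend (p := Submodule.span (ZMod 2)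
    (Set.range fun x : V => incidence (p x))) ((Module.Basis.span hli).constr (ZMod 2) v)
  refine ⟨fun j a => φ (Pi.single j (Pi.single a 1)), fun x => ?_⟩
  have h1 : incidence (p x) = ∑ j, Pi.single j (Pi.single (p x j) (1 : ZMod 2)) := by
    rw [Finset.univ_sum_single]; rfl
  have h2 : tabulate (fun j a => φ (Pi.single j (Pi.single a 1))) (p x) =
      φ (incidence (p x)) := by
    rw [h1, map_sum]; rfl
  rw [h2]
  have h3 : incidence (p x) = ((Module.Basis.span hli x : Submodule.span (ZMod 2)
    (Set.range fun x : V => incidence (p x))) : ι → σ → ZMod 2) := by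
    rw [Module.Basis.span_apply]
  rw [h3, ← Submodule.subtype_apply, ← LinearMap.comp_apply, hφ, Module.Basis.constr_basis]

/-- The values of simple tabulation on an independent set are independent and uniform. -/
theorem Indep.card_tabulate_mem [Fintype σ] {M : Type*} [AddCommGroup M] [Module (ZMod 2) M]
    [Fintype M] {p : X → ι → σ} {V : Finset X} (h : Indep p V) (B : Finset (V → M)) :
    #{g : ι → σ → M | (fun x : V => tabulate g (p x)) ∈ B} * Fintype.card M ^ #V =
      #B * Fintype.card (ι → σ → M) := by
  let φ : (ι → σ → M) →+ (V → M) :=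
    { toFun := fun g x => tabulate g (p x)
      map_zero' := by funext x; simp [tabulate]
      map_add' := fun g g' => by funext x; simp [tabulate, Finset.sum_add_distrib] }
  have hsurj : ∀ v, v ∈ Set.range φ := fun v => by
    obtain ⟨g, hg⟩ := h.exists_tabulate_eq v
    exact ⟨g, funext hg⟩
  -- All fibres of a surjective homomorphism have the size of its kernel.
  have key : ∀ B : Finset (V → M), #{g : ι → σ → M | φ g ∈ B} = #B * #{g | φ g = 0} := by
    intro B
    rw [Finset.card_eq_sum_card_fiberwise (f := φ) (t := B) (fun g hg => by simpa using hg)]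
    rw [Finset.sum_const_nat]
    intro v hv
    rw [← AddMonoidHom.card_fiber_eq_of_mem_range φ (hsurj v) (hsurj 0)]
    congr 1
    ext g
    simp only [mem_filter, mem_univ, true_and]
    exact ⟨fun h => h.2, fun h => ⟨h ▸ hv, h⟩⟩
  have h1 := key B
  have h2 := key univ
  simp only [mem_univ, filter_true, card_univ, Fintype.card_fun, Fintype.card_coe] at h2
  change #{g : ι → σ → M | φ g ∈ B} * _ = _
  rw [h1, Fintype.card_fun, Fintype.card_fun, h2]
  ring

end ZeroSets

/-! ### Counting words in which every letter occurs an even number of times -/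

section EvenWords

open Finset
open scoped Classical

/-- The number `(2 * m - 1)‼` of perfect matchings of `2 * m` points. -/
def numMatchings : ℕ → ℕ
  | 0 => 1
  | m + 1 => (2 * m + 1) * numMatchings m

variable {X ι σ M : Type*}

/-- The letter `a` occurs at one of n + 1 positions, and deleting it there leaves an even word. -/
theorem card_words_single_le [Fintype M] (n : ℕ) (a : M) :
    #{v : Fin (n + 1) → M | ∑ i, (Pi.single (v i) 1 : M → ZMod 2) = Pi.single a 1} ≤
      (n + 1) * #{v : Fin n → M | ∑ i, (Pi.single (v i) 1 : M → ZMod 2) = 0} := by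
  set E : Finset (Fin n → M) := {v | ∑ i, (Pi.single (v i) 1 : M → ZMod 2) = 0} with hE
  have hsub : ({v : Fin (n + 1) → M | ∑ i, (Pi.single (v i) 1 : M → ZMod 2) = Pi.single a 1} :
      Finset _) ⊆ (univ : Finset (Fin (n + 1))).biUnion fun i =>
        E.image fun w => (i.insertNth a w : Fin (n + 1) → M) := by
    intro v hv
    simp only [mem_filter, mem_univ, true_and] at hv
    have hex : ∃ i, v i = a := by
      by_contra! hc
      have := congrFun hv a
      rw [Finset.sum_apply] at this
      simp [fun i => (hc i).symm] at this
    obtain ⟨i, hi⟩ := hex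
    simp only [mem_biUnion, mem_univ, true_and, mem_image]
    refine ⟨i, i.removeNth v, ?_, ?_⟩
    · simp only [hE, mem_filter, mem_univ, true_and]
      rw [Fin.sum_univ_succAbove _ i, hi] at hv
      exact add_eq_left.1 hv
    · rw [← hi]; exact Fin.insertNth_self_removeNth i v
  refine (card_le_card hsub).trans (card_biUnion_le.trans ?_)
  refine (sum_le_sum fun i _ => card_image_le).trans ?_
  simp

theorem card_even_words_le [Fintype M] (m : ℕ) :
    #{v : Fin (2 * m) → M | ∑ i, (Pi.single (v i) 1 : M → ZMod 2) = 0} ≤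
      numMatchings m * Fintype.card M ^ m := by
  induction m with
  | zero => simp [numMatchings]
  | succ m ih =>
    have hsub : ({v : Fin (2 * m + 1 + 1) → M | ∑ i, (Pi.single (v i) 1 : M → ZMod 2) = 0} :
        Finset _) ⊆ (univ : Finset M).biUnion fun a =>
          ({w : Fin (2 * m + 1) → M | ∑ i, (Pi.single (w i) 1 : M → ZMod 2) = Pi.single a 1} :
            Finset _).image fun w => (Fin.cons a w : Fin (2 * m + 1 + 1) → M) := by
      intro v hv
      simp only [mem_filter, mem_univ, true_and] at hv
      simp only [mem_biUnion, mem_univ, true_and, mem_image, mem_filter]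
      refine ⟨v 0, Fin.tail v, ?_, Fin.cons_self_tail v⟩
      rw [Fin.sum_univ_succ] at hv
      exact (eq_neg_of_add_eq_zero_right hv).trans (ZModModule.neg_eq_self _)
    calc _ ≤ _ := card_le_card hsub
      _ ≤ _ := card_biUnion_le
      _ ≤ ∑ a : M, (2 * m + 1) * (numMatchings m * Fintype.card M ^ m) :=
          sum_le_sum fun a _ => card_image_le.trans
            ((card_words_single_le _ a).trans (Nat.mul_le_mul_left _ ih))
      _ = _ := by
          rw [sum_const, card_univ, smul_eq_mul, numMatchings]; ring

variable [DecidableEq σ] [Fintype ι] [Fintype σ] [AddCommGroup M] [Module (ZMod 2) M] [Fintype M]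

theorem Indep.card_evenOn_tabulate_le {p : X → ι → σ} {V : Finset X} (h : Indep p V) {m : ℕ}
    (hV : #V = 2 * m) :
    #{g : ι → σ → M | EvenOn (fun x => tabulate g (p x)) V} * Fintype.card M ^ m ≤
      numMatchings m * Fintype.card (ι → σ → M) := by
  have hM : 0 < Fintype.card M := Fintype.card_pos
  set B : Finset (V → M) := {v | ∑ x, (Pi.single (v x) 1 : M → ZMod 2) = 0} with hB
  have hcard : #B ≤ numMatchings m * Fintype.card M ^ m := by
    refine le_trans (le_of_eq ?_) (card_even_words_le m)
    let e : V ≃ Fin (2 * m) := V.equivFinOfCardEq hV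
    refine Finset.card_equiv (e.arrowCongr (Equiv.refl M)) fun v => ?_
    simp only [hB, mem_filter, mem_univ, true_and, Equiv.arrowCongr_apply, Equiv.coe_refl,
      Function.comp_apply, id_eq]
    rw [Equiv.sum_comp e.symm (fun x => (Pi.single (v x) 1 : M → ZMod 2))]
  have h1 := h.card_tabulate_mem B
  have h2 : ({g : ι → σ → M | EvenOn (fun x => tabulate g (p x)) V} : Finset _) =
      ({g : ι → σ → M | (fun x : V => tabulate g (p x)) ∈ B} : Finset _) := by
    ext g
    simp only [hB, mem_filter, mem_univ, true_and]
    rw [evenOn_iff_sum, ← Finset.sum_coe_sort]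
  rw [h2]
  rw [hV, two_mul, pow_add] at h1
  refine Nat.le_of_mul_le_mul_right ?_ (pow_pos hM m)
  calc _ = _ := by rw [mul_assoc]
    _ = _ := h1
    _ ≤ numMatchings m * Fintype.card M ^ m * Fintype.card (ι → σ → M) :=
        Nat.mul_le_mul_right _ hcard
    _ = _ := by ring

/-- Fix x in W. It has a partner u with the same hash value, and by tightness the other 2j elements
are independent, so the count of even words applies to them. The 2j + 1 choices of u complete
`numMatchings (j + 1)`; the coincidence of x and u is not charged, hence only the power j. -/
theorem card_tight_evenOn_tabulate_le [DecidableEq X] (p : X → ι → σ) {W : Finset X} {j : ℕ}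
    (hW : #W = 2 * (j + 1)) :
    #{g : ι → σ → M | EvenOn (fun x => tabulate g (p x)) W ∧ ∀ u ∈ W, ∀ v ∈ W, u ≠ v →
        tabulate g (p u) = tabulate g (p v) → Indep p ((W.erase u).erase v)} *
      Fintype.card M ^ j ≤ numMatchings (j + 1) * Fintype.card (ι → σ → M) := by
  obtain ⟨x, hx⟩ : W.Nonempty := card_pos.1 (by omega)
  have hsub : ({g : ι → σ → M | EvenOn (fun x => tabulate g (p x)) W ∧ ∀ u ∈ W, ∀ v ∈ W, u ≠ v →
      tabulate g (p u) = tabulate g (p v) → Indep p ((W.erase u).erase v)} : Finset _) ⊆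
      ((W.erase x).filter fun u => Indep p ((W.erase x).erase u)).biUnion fun u =>
        {g : ι → σ → M | EvenOn (fun x => tabulate g (p x)) ((W.erase x).erase u)} := by
    intro g hg
    simp only [mem_filter, mem_univ, true_and] at hg
    obtain ⟨u, hu, hxu⟩ := hg.1.exists_partner hx
    obtain ⟨hux, huW⟩ := mem_erase.1 hu
    simp only [mem_biUnion, mem_filter, mem_univ, true_and]
    exact ⟨u, ⟨hu, hg.2 x hx u huW hux.symm hxu⟩, hg.1.erase_pair hx huW hux.symm hxu⟩
  calc _ ≤ (∑ u ∈ (W.erase x).filter fun u => Indep p ((W.erase x).erase u),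
        #{g : ι → σ → M | EvenOn (fun x => tabulate g (p x)) ((W.erase x).erase u)}) *
          Fintype.card M ^ j :=
        Nat.mul_le_mul_right _ ((card_le_card hsub).trans card_biUnion_le)
    _ ≤ ∑ u ∈ (W.erase x).filter fun u => Indep p ((W.erase x).erase u),
        numMatchings j * Fintype.card (ι → σ → M) := by
        rw [sum_mul]
        refine sum_le_sum fun u hu => ?_
        obtain ⟨hu, hind⟩ := mem_filter.1 hu
        refine hind.card_evenOn_tabulate_le ?_
        rw [card_erase_of_mem hu, card_erase_of_mem hx, hW]
        omega
    _ ≤ (2 * j + 1) * (numMatchings j * Fintype.card (ι → σ → M)) := by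
        rw [sum_const, smul_eq_mul]
        refine Nat.mul_le_mul_right _ ((card_filter_le _ _).trans ?_)
        rw [card_erase_of_mem hx, hW]
        omega
    _ = _ := by rw [numMatchings]; ring

end EvenWords

/-! ### Minimal zero sets when one derived character is appended -/

section OneStep

open Finset
open scoped Classical

/-- A bound for the probability that a word of `2 * t` characters is even, when all but one of
its characters are independent and uniform over an alphabet of `N` characters. -/
noncomputable def matchRate (N t : ℕ) : ℝ := numMatchings t / (N : ℝ) ^ (t - 1)

theorem matchRate_nonneg (N t : ℕ) : 0 ≤ matchRate N t := by unfold matchRate; positivity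

theorem matchRate_succ (N : ℕ) {t : ℕ} (ht : 1 ≤ t) :
    matchRate N (t + 1) = matchRate N t * ((2 * t + 1) / N) := by
  obtain ⟨t, rfl⟩ := Nat.exists_eq_add_of_le' ht
  simp only [matchRate, numMatchings, Nat.add_sub_cancel, Nat.cast_mul, pow_succ]
  push_cast
  ring

/-- Consecutive rates have ratio (2t + 1)/N. This monotonicity is the reason why set sizes are kept
at most N. -/
theorem matchRate_anti {N s t : ℕ} (hs : 1 ≤ s) (hst : s ≤ t) (ht : 2 * t ≤ N) :
    matchRate N t ≤ matchRate N s := by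
  induction t, hst using Nat.le_induction with
  | base => exact le_rfl
  | succ t hst ih =>
    rw [matchRate_succ N (hs.trans hst)]
    refine le_trans (mul_le_of_le_one_right (matchRate_nonneg _ _) ?_) (ih (by omega))
    rw [div_le_one (by exact_mod_cast (by omega : 0 < N))]
    exact_mod_cast (by omega : 2 * t + 1 ≤ N)

variable {X M : Type*} {m : ℕ}

/-- Append the hash values `q` to the strings `p`. -/
def appendChar (p : X → Fin m → M) (q : X → M) (x : X) : Fin (m + 1) → M :=
  Fin.snoc (α := fun _ => M) (p x) (q x)

theorem isZero_appendChar [DecidableEq M] (p : X → Fin m → M) (q : X → M) (S : Finset X) :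
    IsZero (appendChar p q) S ↔ IsZero p S ∧ EvenOn q S := by
  simp [IsZero, Fin.forall_fin_succ', appendChar]

variable [DecidableEq X]

/-- For z in Z outside L, parity decides whether W contains z. If L = Z the truncated exponent is 0
and the bound is 1. -/
theorem card_even_between_le {L Z : Finset X} (hLZ : L ⊆ Z) :
    #{W ∈ Icc L Z | Even #W} ≤ 2 ^ (#Z - #L - 1) := by
  rcases hLZ.eq_or_ssubset with rfl | hss
  · simpa using card_filter_le ({L} : Finset (Finset X)) (fun W => Even #W)
  · obtain ⟨z, hz, hzL⟩ := exists_of_ssubset hss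
    have hLz : L ⊆ Z.erase z := fun x hx => mem_erase.2 ⟨fun h => hzL (h ▸ hx), hLZ hx⟩
    have := card_Icc_finset hLz
    rw [card_erase_of_mem hz, Nat.sub_right_comm] at this
    rw [← this]
    refine card_le_card_of_injOn (fun W => W.erase z) ?_ ?_
    · intro W hW
      simp only [coe_filter, mem_Icc, Set.mem_ofPred_eq] at hW
      simp only [coe_Icc, Set.mem_Icc]
      exact ⟨fun x hx => mem_erase.2 ⟨fun h => hzL (h ▸ hx), hW.1.1 hx⟩, erase_subset_erase _ hW.1.2⟩
    · intro W hW W' hW' h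
      simp only [coe_filter, mem_Icc, Set.mem_ofPred_eq] at hW hW' h
      have key : ∀ U U' : Finset X, Even #U → Even #U' → U.erase z = U'.erase z → z ∈ U → z ∈ U' := by
        intro U U' hU hU' h hz
        by_contra hz'
        rw [erase_eq_of_notMem hz'] at h
        have h1 := card_erase_add_one hz
        rw [h] at h1
        rw [← h1] at hU
        exact (Nat.even_add_one.1 hU) hU'
      by_cases hzW : z ∈ W
      · rw [← insert_erase hzW, h, insert_erase (key _ _ hW.2 hW'.2 h hzW)]
      · rw [← erase_eq_of_notMem hzW, h,
          erase_eq_of_notMem fun hzW' => hzW (key _ _ hW'.2 hW.2 h.symm hzW')]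

variable [AddCommGroup M] [Module (ZMod 2) M] [Fintype M] [DecidableEq M]

theorem card_minZero_appendChar_le (p : X → Fin m → M) (hp : Function.Injective p) [NeZero m]
    {Z : Finset X} (hZN : #Z ≤ Fintype.card M) :
    (#{g : Fin m → M → M | MinZero (appendChar p fun x => tabulate g (p x)) Z} : ℝ) ≤
      Fintype.card (Fin m → M → M) * ∑ L ∈ Z.powerset with MinZero p L,
        2 ^ (#Z - #L - 1) * matchRate (Fintype.card M) (#L / 2) := by
  set N := Fintype.card M with hN
  have hNpos : 0 < N := Fintype.card_pos
  set G := Fintype.card (Fin m → M → M)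
  let F : Finset X → Finset (Fin m → M → M) := fun W =>
    {g | EvenOn (fun x => tabulate g (p x)) W ∧ ∀ u ∈ W, ∀ v ∈ W, u ≠ v →
        tabulate g (p u) = tabulate g (p v) → Indep p ((W.erase u).erase v)}
  have hsub : ({g : Fin m → M → M | MinZero (appendChar p fun x => tabulate g (p x)) Z} :
      Finset _) ⊆ (Z.powerset.filter fun W => Even #W ∧ ¬ Indep p W).biUnion F := by
    intro g hg
    simp only [mem_filter, mem_univ, true_and] at hg
    obtain ⟨hz, hq⟩ := (isZero_appendChar _ _ _).1 hg.2.1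
    obtain ⟨W, hWZ, hW, hqW, htight⟩ := exists_tight_dependent hg.1 hz hq
    simp only [mem_biUnion, mem_filter, mem_powerset, mem_univ, true_and, F]
    exact ⟨W, ⟨hWZ, hqW.even_card, hW⟩, hqW, htight⟩
  have hF : ∀ W, Even #W → 4 ≤ #W → (#(F W) : ℝ) ≤ G * matchRate N (#W / 2) := by
    intro W hW h4
    obtain ⟨j, hj⟩ : ∃ j, #W = 2 * (j + 1) := by
      obtain ⟨r, hr⟩ := hW
      exact ⟨r - 1, by omega⟩
    have h1 : #(F W) * N ^ j ≤ numMatchings (j + 1) * G := by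
      convert card_tight_evenOn_tabulate_le (M := M) p hj
    have h2 : (#(F W) : ℝ) * (N : ℝ) ^ j ≤ numMatchings (j + 1) * G := by exact_mod_cast h1
    rw [hj, Nat.mul_div_cancel_left _ two_pos, matchRate, Nat.add_sub_cancel, mul_div_assoc',
      le_div_iff₀ (by positivity), mul_comm (G : ℝ)]
    exact h2
  calc (#{g : Fin m → M → M | MinZero (appendChar p fun x => tabulate g (p x)) Z} : ℝ)
      ≤ ∑ W ∈ Z.powerset with (Even #W ∧ ¬ Indep p W), (#(F W) : ℝ) := by
        exact_mod_cast (card_le_card hsub).trans card_biUnion_le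
    _ ≤ ∑ W ∈ Z.powerset with (Even #W ∧ ¬ Indep p W),
          ∑ L ∈ Z.powerset with (MinZero p L ∧ L ⊆ W), G * matchRate N (#L / 2) := by
        refine sum_le_sum fun W hW => ?_
        simp only [mem_filter, mem_powerset] at hW
        obtain ⟨L, hLW, hL⟩ := exists_minZero_of_not_indep hW.2.2
        have h4 := hL.four_le_card hp
        have hLWc := card_le_card hLW
        have hWZc := card_le_card hW.1
        -- Monotonicity replaces |W| by |L|, so the cost depends on L alone and the sums over W and
        -- L can be exchanged.
        refine (hF W hW.2.1 (by omega)).trans ?_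
        refine le_trans ?_ (single_le_sum (f := fun L : Finset X => G * matchRate N (#L / 2))
          (fun L _ => mul_nonneg (Nat.cast_nonneg _) (matchRate_nonneg _ _)) (a := L) ?_)
        · exact mul_le_mul_of_nonneg_left (matchRate_anti (by omega)
            (Nat.div_le_div_right hLWc) (by omega)) (Nat.cast_nonneg _)
        · simp only [mem_filter, mem_powerset]
          exact ⟨hLW.trans hW.1, hL, hLW⟩
    _ = ∑ L ∈ Z.powerset with MinZero p L,
          ∑ W ∈ Z.powerset with ((Even #W ∧ ¬ Indep p W) ∧ L ⊆ W),
            G * matchRate N (#L / 2) := by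
        refine sum_comm' fun W L => ?_
        simp only [mem_filter, mem_powerset]
        tauto
    _ ≤ ∑ L ∈ Z.powerset with MinZero p L,
          G * (2 ^ (#Z - #L - 1) * matchRate N (#L / 2)) := by
        refine sum_le_sum fun L hL => ?_
        simp only [mem_filter, mem_powerset] at hL
        rw [sum_const, nsmul_eq_mul, mul_left_comm]
        refine mul_le_mul_of_nonneg_left ?_ (Nat.cast_nonneg _)
        refine mul_le_mul_of_nonneg_right ?_ (matchRate_nonneg _ _)
        have hsub' : ({W ∈ Z.powerset | (Even #W ∧ ¬ Indep p W) ∧ L ⊆ W} : Finset _) ⊆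
            {W ∈ Icc L Z | Even #W} := by
          intro W
          simp only [mem_filter, mem_powerset, mem_Icc]
          tauto
        exact_mod_cast (card_le_card hsub').trans (card_even_between_le hL.1)
    _ = _ := by rw [mul_sum]

theorem card_powersetCard_filter_superset_le {A L : Finset X} (r : ℕ) :
    #{Z ∈ powersetCard r A | L ⊆ Z} ≤ (#A).choose (r - #L) := by
  rw [← card_powersetCard]
  refine card_le_card_of_injOn (fun Z => Z \ L) ?_ ?_
  · intro Z hZ
    simp only [coe_filter, mem_powersetCard, Set.mem_ofPred_eq] at hZ
    simp only [mem_coe, mem_powersetCard]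
    exact ⟨sdiff_subset.trans hZ.1.1, by rw [card_sdiff_of_subset hZ.2, hZ.1.2]⟩
  · intro Z hZ Z' hZ' h
    simp only [coe_filter, Set.mem_ofPred_eq] at hZ hZ' h
    rw [← sdiff_union_of_subset hZ.2, h, sdiff_union_of_subset hZ'.2]

theorem sum_card_minZero_appendChar_le (p : X → Fin m → M) (hp : Function.Injective p) [NeZero m]
    (A : Finset X) {r : ℕ} (hr : 2 * r ≤ Fintype.card M) :
    (∑ g : Fin m → M → M,
        #{Z ∈ powersetCard (2 * r) A | MinZero (appendChar p fun x => tabulate g (p x)) Z} : ℝ) ≤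
      Fintype.card (Fin m → M → M) * ∑ t ∈ Icc 2 r,
        (#A).choose (2 * (r - t)) * 2 ^ (2 * (r - t) - 1) * matchRate (Fintype.card M) t *
          #{L ∈ powersetCard (2 * t) A | MinZero p L} := by
  set N := Fintype.card M with hN
  set G := Fintype.card (Fin m → M → M)
  let w : Finset X → ℝ := fun L => 2 ^ (2 * r - #L - 1) * matchRate N (#L / 2)
  have hw : ∀ L, 0 ≤ w L := fun L => mul_nonneg (by positivity) (matchRate_nonneg _ _)
  let E : Finset (Finset X) := {L ∈ A.powerset | MinZero p L ∧ #L ≤ 2 * r}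
  calc (∑ g : Fin m → M → M,
        #{Z ∈ powersetCard (2 * r) A | MinZero (appendChar p fun x => tabulate g (p x)) Z} : ℝ)
      = ∑ Z ∈ powersetCard (2 * r) A,
          (#{g : Fin m → M → M | MinZero (appendChar p fun x => tabulate g (p x)) Z} : ℝ) := by
        simp only [card_filter, Nat.cast_sum]
        rw [sum_comm]
    _ ≤ ∑ Z ∈ powersetCard (2 * r) A, G * ∑ L ∈ Z.powerset with MinZero p L, w L := by
        refine sum_le_sum fun Z hZ => ?_
        have hZc := (mem_powersetCard.1 hZ).2
        have := card_minZero_appendChar_le p hp (Z := Z) (by omega)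
        rwa [hZc] at this
    _ = G * ∑ L ∈ E, ∑ Z ∈ powersetCard (2 * r) A with L ⊆ Z, w L := by
        rw [← mul_sum]
        congr 1
        refine sum_comm' fun Z L => ?_
        simp only [mem_filter, mem_powerset, mem_powersetCard, E]
        constructor
        · rintro ⟨⟨h1, h2⟩, h3, h4⟩
          exact ⟨⟨⟨h1, h2⟩, h3⟩, h3.trans h1, h4, h2 ▸ card_le_card h3⟩
        · tauto
    _ ≤ G * ∑ L ∈ E, (#A).choose (2 * r - #L) * w L := by
        refine mul_le_mul_of_nonneg_left (sum_le_sum fun L _ => ?_) (Nat.cast_nonneg _)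
        rw [sum_const, nsmul_eq_mul]
        refine mul_le_mul_of_nonneg_right ?_ (hw L)
        exact_mod_cast card_powersetCard_filter_superset_le _
    _ = G * ∑ t ∈ Icc 2 r, ∑ L ∈ E with #L / 2 = t, (#A).choose (2 * r - #L) * w L := by
        rw [sum_fiberwise_of_maps_to]
        intro L hL
        simp only [mem_filter, E] at hL
        have := hL.2.1.four_le_card hp
        rw [mem_Icc]
        omega
    _ ≤ _ := by
        refine mul_le_mul_of_nonneg_left (sum_le_sum fun t ht => ?_) (Nat.cast_nonneg _)
        have hcard : ∀ L ∈ E.filter fun L => #L / 2 = t, #L = 2 * t := by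
          intro L hL
          simp only [mem_filter, E] at hL
          obtain ⟨s, hs⟩ := hL.1.2.1.2.1.even_card
          omega
        have : ∀ L ∈ E.filter fun L => #L / 2 = t, (#A).choose (2 * r - #L) * w L =
            (#A).choose (2 * (r - t)) * 2 ^ (2 * (r - t) - 1) * matchRate N t := by
          intro L hL
          simp only [w]
          rw [hcard L hL, Nat.mul_div_cancel_left _ two_pos, ← Nat.mul_sub, mul_assoc]
        rw [sum_congr rfl this, sum_const, nsmul_eq_mul, mul_comm]
        refine mul_le_mul_of_nonneg_left ?_
          (mul_nonneg (by positivity) (matchRate_nonneg _ _))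
        refine Nat.cast_le.2 (card_le_card fun L hL => ?_)
        have hc := hcard L hL
        simp only [mem_filter, mem_powerset, E] at hL
        exact mem_filter.2 ⟨mem_powersetCard.2 ⟨hL.1.1, hc⟩, hL.1.2.1⟩

end OneStep

/-! ### Additive energy of incidence vectors and zero sets of keys -/

section ZeroQuadruples

open Finset
open scoped Classical

/-- The left side is a sum of products of fibre sizes of φ and τ ∘ φ. By 2ab ≤ a² + b² it is at most
the mean of the two sums of squares, which agree because τ is injective. -/
theorem card_filter_eq_comp_le {α K : Type*} [DecidableEq K] (Q : Finset α) (φ : α → K) {τ : K → K}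
    (hτ : Function.Injective τ) :
    #{z ∈ Q ×ˢ Q | φ z.1 = τ (φ z.2)} ≤ #{z ∈ Q ×ˢ Q | φ z.1 = φ z.2} := by
  have key : ∀ ψ : α → K, #{z ∈ Q ×ˢ Q | φ z.1 = ψ z.2} =
      ∑ k ∈ Q.image φ ∪ Q.image ψ, #{x ∈ Q | φ x = k} * #{x ∈ Q | ψ x = k} := by
    intro ψ
    rw [card_eq_sum_card_fiberwise (f := fun z => φ z.1) (t := Q.image φ ∪ Q.image ψ)]
    · refine sum_congr rfl fun k _ => ?_
      rw [← card_product]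
      congr 1
      ext z
      simp only [mem_filter, mem_product]
      constructor
      · rintro ⟨⟨h1, h2⟩, h3⟩
        exact ⟨⟨h1.1, h3⟩, h1.2, h2 ▸ h3⟩
      · rintro ⟨⟨h1, h2⟩, h3, h4⟩
        exact ⟨⟨⟨h1, h3⟩, h2.trans h4.symm⟩, h2⟩
    · intro z hz
      simp only [coe_filter, mem_product, Set.mem_ofPred_eq] at hz
      exact mem_union_left _ (mem_image_of_mem _ hz.1.1)
  have sq : ∀ (ψ : α → K) (I : Finset K), Q.image ψ ⊆ I →
      ∑ k ∈ I, #{x ∈ Q | ψ x = k} ^ 2 = #{z ∈ Q ×ˢ Q | ψ z.1 = ψ z.2} := by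
    intro ψ I hI
    rw [card_eq_sum_card_fiberwise (f := fun z => ψ z.1) (t := I)]
    · refine sum_congr rfl fun k _ => ?_
      rw [sq, ← card_product]
      congr 1
      ext z
      simp only [mem_filter, mem_product]
      constructor
      · rintro ⟨⟨h1, h2⟩, h3, h4⟩
        exact ⟨⟨⟨h1, h3⟩, h2.trans h4.symm⟩, h2⟩
      · rintro ⟨⟨h1, h2⟩, h3⟩
        exact ⟨⟨h1.1, h3⟩, h1.2, h2 ▸ h3⟩
    · intro z hz
      simp only [coe_filter, mem_product, Set.mem_ofPred_eq] at hz
      exact hI (mem_image_of_mem _ hz.1.1)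
  set I := Q.image φ ∪ Q.image fun x => τ (φ x)
  have h1 := key fun x => τ (φ x)
  have h2 := sq φ I subset_union_left
  have h3 := sq (fun x => τ (φ x)) I subset_union_right
  simp only [hτ.eq_iff] at h3
  have h4 : ∑ k ∈ I, 2 * (#{x ∈ Q | φ x = k} * #{x ∈ Q | τ (φ x) = k}) ≤
      ∑ k ∈ I, (#{x ∈ Q | φ x = k} ^ 2 + #{x ∈ Q | τ (φ x) = k} ^ 2) := by
    refine sum_le_sum fun k _ => ?_
    rw [← mul_assoc]
    exact two_mul_le_add_sq _ _
  rw [← mul_sum, sum_add_distrib, h2, h3] at h4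
  rw [h1]
  change _ ≤ #{z ∈ Q ×ˢ Q | φ z.1 = φ z.2} + #{z ∈ Q ×ˢ Q | φ z.1 = φ z.2} at h4
  exact Nat.le_of_mul_le_mul_left (h4.trans_eq (two_mul _).symm) two_pos

/-- The alternatives are the three ways to pair four characters; they produce one factor 3 per
position. -/
theorem single_add_single_eq {σ : Type*} [DecidableEq σ] {a b a' b' : σ}
    (h : (Pi.single a 1 + Pi.single b 1 : σ → ZMod 2) = Pi.single a' 1 + Pi.single b' 1) :
    (a = a' ∧ b = b') ∨ (a = b' ∧ b = a') ∨ (a = b ∧ a' = b') := by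
  have inj : ∀ x y : σ, (Pi.single x 1 : σ → ZMod 2) = Pi.single y 1 → x = y := by
    intro x y hxy
    by_contra hne
    have := congrFun hxy x
    simp [hne] at this
  by_cases h1 : a = a'
  · subst h1
    exact Or.inl ⟨rfl, inj _ _ (add_left_cancel h)⟩
  by_cases h2 : a = b'
  · subst h2
    rw [add_comm (Pi.single a' 1)] at h
    exact Or.inr (Or.inl ⟨rfl, inj _ _ (add_left_cancel h)⟩)
  have h3 : a = b := by
    by_contra h3
    have := congrFun h a
    simp [h1, h2, h3] at this
  subst h3
  rw [ZModModule.add_self] at h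
  refine Or.inr (Or.inr ⟨rfl, inj _ _ ?_⟩)
  rw [← sub_eq_zero, ZModModule.sub_eq_add, ← h]

variable {X ι σ : Type*} [DecidableEq σ] [Fintype ι]

/-- The exchange at positions of type 1 is an injective τ, so it may be dropped. Without it, the
first key of the first pair and the second key of the second pair determine the other two. -/
theorem card_patterned_pairs_le {p : X → ι → σ} (hp : Function.Injective p) (A : Finset X)
    (π : ι → Fin 3) :
    #{z ∈ (A ×ˢ A) ×ˢ (A ×ˢ A) | ∀ j,
      (π j = 0 → p z.1.1 j = p z.2.1 j ∧ p z.1.2 j = p z.2.2 j) ∧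
      (π j = 1 → p z.1.1 j = p z.2.2 j ∧ p z.1.2 j = p z.2.1 j) ∧
      (π j = 2 → p z.1.1 j = p z.1.2 j ∧ p z.2.1 j = p z.2.2 j)} ≤ #A ^ 2 := by
  let Q : Finset (X × X) := {q ∈ A ×ˢ A | ∀ j, π j = 2 → p q.1 j = p q.2 j}
  let φ : X × X → ι → Option (σ × σ) := fun q j =>
    if π j = 2 then none else some (p q.1 j, p q.2 j)
  let τ : (ι → Option (σ × σ)) → ι → Option (σ × σ) := fun k j =>
    if π j = 1 then (k j).map Prod.swap else k j
  have hτ : Function.Injective τ := by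
    refine Function.Involutive.injective fun k => funext fun j => ?_
    by_cases h : π j = 1 <;> simp [τ, h]
  calc _ ≤ #{z ∈ Q ×ˢ Q | φ z.1 = τ (φ z.2)} := by
        refine card_le_card fun z hz => ?_
        simp only [mem_filter, mem_product] at hz
        simp only [mem_filter, mem_product, Q]
        refine ⟨⟨⟨hz.1.1, fun j hj => ((hz.2 j).2.2 hj).1⟩,
          ⟨hz.1.2, fun j hj => ((hz.2 j).2.2 hj).2⟩⟩, funext fun j => ?_⟩
        have h3 : ∀ i : Fin 3, i = 0 ∨ i = 1 ∨ i = 2 := by decide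
        rcases h3 (π j) with h | h | h
        · simp [φ, τ, h, (hz.2 j).1 h]
        · simp [φ, τ, h, (hz.2 j).2.1 h]
        · simp [φ, τ, h]
    _ ≤ #{z ∈ Q ×ˢ Q | φ z.1 = φ z.2} := card_filter_eq_comp_le Q φ hτ
    _ ≤ #(A ×ˢ A) := by
        refine card_le_card_of_injOn (fun z => (z.1.1, z.2.2)) ?_ ?_
        · intro z hz
          simp only [coe_filter, mem_product, mem_filter, Set.mem_ofPred_eq, Q] at hz
          exact mem_coe.2 (mem_product.2 ⟨hz.1.1.1.1, hz.1.2.1.2⟩)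
        · rintro ⟨⟨x, y⟩, ⟨x', y'⟩⟩ hz ⟨⟨u, v⟩, ⟨u', v'⟩⟩ hw heq
          simp only [Prod.mk.injEq] at heq
          obtain ⟨rfl, rfl⟩ := heq
          simp only [coe_filter, mem_product, mem_filter, Set.mem_ofPred_eq, Q] at hz hw
          obtain ⟨⟨⟨-, hz1⟩, -, hz2⟩, hz3⟩ := hz
          obtain ⟨⟨⟨-, hw1⟩, -, hw2⟩, hw3⟩ := hw
          have hφ : ∀ j, π j ≠ 2 → ∀ {q q' : X × X}, φ q = φ q' →
              p q.1 j = p q'.1 j ∧ p q.2 j = p q'.2 j := by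
            intro j hj q q' h
            have := congrFun h j
            simpa [φ, hj] using this
          have e1 : y = v := hp (funext fun j => by
            by_cases hj : π j = 2
            · rw [← hz1 j hj, ← hw1 j hj]
            · rw [(hφ j hj hz3).2, (hφ j hj hw3).2])
          have e2 : x' = u' := hp (funext fun j => by
            by_cases hj : π j = 2
            · rw [hz2 j hj, hw2 j hj]
            · rw [← (hφ j hj hz3).1, ← (hφ j hj hw3).1])
          rw [e1, e2]
    _ = #A ^ 2 := by rw [card_product, sq]

/-- The additive energy of a set of incidence vectors. -/
theorem card_incidence_energy_le {p : X → ι → σ} (hp : Function.Injective p) (A : Finset X) :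
    #{z ∈ (A ×ˢ A) ×ˢ (A ×ˢ A) | incidence (p z.1.1) + incidence (p z.1.2) =
      incidence (p z.2.1) + incidence (p z.2.2)} ≤ 3 ^ Fintype.card ι * #A ^ 2 := by
  have hsub : ({z ∈ (A ×ˢ A) ×ˢ (A ×ˢ A) | incidence (p z.1.1) + incidence (p z.1.2) =
      incidence (p z.2.1) + incidence (p z.2.2)} : Finset _) ⊆
      (univ : Finset (ι → Fin 3)).biUnion fun π => {z ∈ (A ×ˢ A) ×ˢ (A ×ˢ A) | ∀ j,
        (π j = 0 → p z.1.1 j = p z.2.1 j ∧ p z.1.2 j = p z.2.2 j) ∧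
        (π j = 1 → p z.1.1 j = p z.2.2 j ∧ p z.1.2 j = p z.2.1 j) ∧
        (π j = 2 → p z.1.1 j = p z.1.2 j ∧ p z.2.1 j = p z.2.2 j)} := by
    intro z hz
    simp only [mem_filter] at hz
    have : ∀ j, ∃ i : Fin 3,
        (i = 0 → p z.1.1 j = p z.2.1 j ∧ p z.1.2 j = p z.2.2 j) ∧
        (i = 1 → p z.1.1 j = p z.2.2 j ∧ p z.1.2 j = p z.2.1 j) ∧
        (i = 2 → p z.1.1 j = p z.1.2 j ∧ p z.2.1 j = p z.2.2 j) := by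
      intro j
      rcases single_add_single_eq (congrFun hz.2 j) with h | h | h
      · exact ⟨0, by simp [h]⟩
      · exact ⟨1, by simp [h]⟩
      · exact ⟨2, by simp [h]⟩
    choose π hπ using this
    simp only [mem_biUnion, mem_univ, true_and, mem_filter]
    exact ⟨π, hz.1, hπ⟩
  refine (card_le_card hsub).trans (card_biUnion_le.trans
    ((sum_le_sum fun π _ => card_patterned_pairs_le hp A π).trans ?_))
  simp

theorem card_incidence_sum_eq_le {p : X → ι → σ} (hp : Function.Injective p) (A : Finset X)
    (v : ι → σ → ZMod 2) :
    #{z ∈ (A ×ˢ A) ×ˢ (A ×ˢ A) | incidence (p z.1.1) + incidence (p z.1.2) =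
      v + (incidence (p z.2.1) + incidence (p z.2.2))} ≤ 3 ^ Fintype.card ι * #A ^ 2 :=
  (card_filter_eq_comp_le (A ×ˢ A) (fun q => incidence (p q.1) + incidence (p q.2))
    (add_right_injective v)).trans (card_incidence_energy_le hp A)

/-- All but four keys are chosen freely; the sum of the last four incidence vectors is then
prescribed, which the energy bound controls. -/
theorem card_isZero_le [DecidableEq X] {p : X → ι → σ} (hp : Function.Injective p) (A : Finset X) (r : ℕ) :
    #{L ∈ powersetCard (r + 4) A | IsZero p L} ≤
      (#A).choose r * (3 ^ Fintype.card ι * #A ^ 2) := by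
  let E : Finset X → Finset ((X × X) × X × X) := fun S =>
    {z ∈ (A ×ˢ A) ×ˢ (A ×ˢ A) | incidence (p z.1.1) + incidence (p z.1.2) =
      ∑ x ∈ S, incidence (p x) + (incidence (p z.2.1) + incidence (p z.2.2))}
  have hsub : ({L ∈ powersetCard (r + 4) A | IsZero p L} : Finset _) ⊆
      (powersetCard r A).biUnion fun S => (E S).image fun z =>
        S ∪ ({z.1.1, z.1.2, z.2.1, z.2.2} : Finset X) := by
    intro L hL
    simp only [mem_filter, mem_powersetCard] at hL
    obtain ⟨⟨hLA, hLc⟩, hz⟩ := hL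
    obtain ⟨S, hSL, hS⟩ := exists_subset_card_eq (show r ≤ #L by omega)
    have hd : #(L \ S) = 3 + 1 := by rw [card_sdiff_of_subset hSL]; omega
    obtain ⟨x, U, hxU, hxU', hU⟩ := card_eq_succ.1 hd
    obtain ⟨y, z, w, hyz, hyw, hzw, rfl⟩ := card_eq_three.1 hU
    have hmem : ∀ u ∈ ({x, y, z, w} : Finset X), u ∈ A := fun u hu =>
      hLA (sdiff_subset (hxU' ▸ hu))
    simp only [mem_biUnion, mem_powersetCard, mem_image]
    refine ⟨S, ⟨hSL.trans hLA, hS⟩, ((x, y), (z, w)), ?_, ?_⟩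
    · simp only [E, mem_filter, mem_product]
      refine ⟨⟨⟨hmem x (by simp), hmem y (by simp)⟩, hmem z (by simp), hmem w (by simp)⟩, ?_⟩
      rw [isZero_iff_sum, ← sum_sdiff hSL, ← hxU', sum_insert hxU,
        sum_insert (by simp [hyz, hyw]), sum_insert (by simp [hzw]), sum_singleton] at hz
      rw [← ZModModule.sub_eq_add, sub_eq_zero] at hz
      rw [← hz, ← sub_eq_zero, ZModModule.sub_eq_add]
      have h2 : ∀ a : ι → σ → ZMod 2, a + a = 0 := ZModModule.add_self
      linear_combination h2 (incidence (p x)) + h2 (incidence (p y)) +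
        h2 (incidence (p z)) + h2 (incidence (p w))
    · change S ∪ {x, y, z, w} = L
      rw [hxU', union_sdiff_of_subset hSL]
  calc _ ≤ _ := card_le_card hsub
    _ ≤ _ := card_biUnion_le
    _ ≤ ∑ S ∈ powersetCard r A, 3 ^ Fintype.card ι * #A ^ 2 :=
        sum_le_sum fun S _ => card_image_le.trans (card_incidence_sum_eq_le hp A _)
    _ = _ := by rw [sum_const, card_powersetCard, smul_eq_mul]

end ZeroQuadruples

/-! ### Expected numbers of minimal zero sets after several derived characters -/

section Levels

open Finset
open scoped Classical

/-- Resampling one component of a uniformly random element does not change averages. -/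
theorem sum_sum_resample {Ω G : Type*} [Fintype Ω] [Fintype G] {get : Ω → G} {set : Ω → G → Ω}
    (get_set : ∀ T g, get (set T g) = g) (set_set : ∀ T g g', set (set T g) g' = set T g')
    (set_get : ∀ T, set T (get T) = T) (F : Ω → ℝ) :
    ∑ T, ∑ g, F (set T g) = Fintype.card G * ∑ T, F T := by
  have hinv : Function.Involutive fun z : Ω × G => (set z.1 z.2, get z.1) := fun z => by
    simp [get_set, set_set, set_get]
  have := Equiv.sum_comp hinv.toPerm fun z : Ω × G => F z.1
  rw [Fintype.sum_prod_type, Fintype.sum_prod_type] at this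
  refine this.trans ?_
  simp [mul_sum]

noncomputable instance (c d k l : ℕ) : Fintype (Tables c d k l) := Fintype.ofFinite _

variable {c d k l : ℕ}

/-- Replace the tables of one derived character. -/
def Tables.setDerive (T : Tables c d k l) (i : Fin d) (g : Fin (c + i) → Bits k → Bits k) :
    Tables c d k l :=
  { T with derive := Function.update T.derive i g }

theorem derivedPrefix_setDerive (T : Tables c d k l) (i : Fin d)
    (g : Fin (c + i) → Bits k → Bits k) (x : Key c k) (j : ℕ) (hj : j ≤ d) (hji : j ≤ i) :
    derivedPrefix (T.setDerive i g) x j hj = derivedPrefix T x j hj := by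
  induction j with
  | zero => rfl
  | succ j ih =>
    have hne : (⟨j, hj⟩ : Fin d) ≠ i := fun h => by
      have := congrArg Fin.val h
      simp only at this
      omega
    simp only [derivedPrefix]
    rw [ih (by omega) (by omega)]
    simp only [Tables.setDerive, Function.update_of_ne hne]

theorem derivedPrefix_succ_setDerive (T : Tables c d k l) (i : ℕ) (hi : i + 1 ≤ d)
    (g : Fin (c + i) → Bits k → Bits k) :
    (fun x => derivedPrefix (T.setDerive ⟨i, hi⟩ g) x (i + 1) hi) =
      appendChar (fun x => derivedPrefix T x i (Nat.le_of_succ_le hi))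
        (fun x => tabulate g (derivedPrefix T x i (Nat.le_of_succ_le hi))) := by
  funext x
  simp only [derivedPrefix, appendChar]
  rw [derivedPrefix_setDerive T ⟨i, hi⟩ g x i (Nat.le_of_succ_le hi) le_rfl]
  simp only [Tables.setDerive, Function.update_self]
  rfl

theorem twisted_injective (T : Tables c d k l) : Function.Injective (twisted T) := by
  intro x y h
  have h1 : ∀ j : Fin c, (j : ℕ) + 1 < c → x j = y j := fun j hj => by
    simpa [twisted, hj] using congrFun h j
  funext j
  by_cases hj : (j : ℕ) + 1 < c
  · exact h1 j hj
  · have h2 := congrFun h j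
    simp only [twisted, hj, if_false] at h2
    have h3 : (fun i => x (Fin.castLE (Nat.sub_le c 1) i)) =
        fun i => y (Fin.castLE (Nat.sub_le c 1) i) := funext fun i => h1 _ (by
      have := i.2
      simp only [Fin.val_castLE]
      omega)
    rw [h3] at h2
    exact add_right_cancel h2

theorem derivedPrefix_injective (T : Tables c d k l) (i : ℕ) (hi : i ≤ d) :
    Function.Injective fun x => derivedPrefix T x i hi := by
  induction i with
  | zero => exact twisted_injective T
  | succ i ih =>
    intro x y h
    exact ih (Nat.le_of_succ_le hi) (Fin.snoc_inj.1 h).1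

theorem two_mul_twelve_pow_le_factorial (m : ℕ) : 2 * 12 ^ m ≤ (2 * (m + 1)).factorial := by
  induction m with
  | zero => simp
  | succ m ih =>
    rw [show 2 * (m + 1 + 1) = 2 * (m + 1) + 1 + 1 by ring, Nat.factorial_succ, Nat.factorial_succ]
    have : 12 ≤ (2 * (m + 1) + 1 + 1) * (2 * (m + 1) + 1) := by nlinarith
    calc 2 * 12 ^ (m + 1) = 12 * (2 * 12 ^ m) := by ring
      _ ≤ (2 * (m + 1) + 1 + 1) * (2 * (m + 1) + 1) * (2 * (m + 1)).factorial :=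
          Nat.mul_le_mul this ih
      _ = _ := by ring

theorem choose_even_mul_two_pow_le {n : ℕ} {R : ℝ} (hn : (n : ℝ) ≤ R / 2) {m : ℕ} (hm : 1 ≤ m) :
    (n.choose (2 * m) : ℝ) * 2 ^ (2 * m - 1) ≤ 3 / 12 ^ m * R ^ (2 * m) := by
  obtain ⟨m, rfl⟩ := Nat.exists_eq_add_of_le' hm
  have hf : (2 * 12 ^ m : ℝ) ≤ (2 * (m + 1)).factorial := by
    exact_mod_cast two_mul_twelve_pow_le_factorial m
  have hR : 0 ≤ R := by have : (0 : ℝ) ≤ n := n.cast_nonneg; linarith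
  calc (n.choose (2 * (m + 1)) : ℝ) * 2 ^ (2 * (m + 1) - 1)
      ≤ (n : ℝ) ^ (2 * (m + 1)) / (2 * (m + 1)).factorial * 2 ^ (2 * (m + 1) - 1) := by
        gcongr; exact Nat.choose_le_pow_div _ _
    _ ≤ (R / 2) ^ (2 * (m + 1)) / (2 * 12 ^ m) * 2 ^ (2 * (m + 1) - 1) := by gcongr
    _ = _ := by
        rw [show 2 * (m + 1) - 1 = 2 * m + 1 by omega, show 2 * (m + 1) = 2 * m + 1 + 1 by ring,
          div_pow]
        field_simp
        ring

/-- The constant 3/8 is preserved by r ↦ r + 1: (3/8)/12 + 3/12 = (3/8)(3/4). -/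
theorem sum_twelfth_pow_le {r : ℕ} (hr : 2 ≤ r) :
    ∑ t ∈ Ico 2 r, 3 / 12 ^ (r - t) * (3 / 4 : ℝ) ^ (t - 1) ≤ 3 / 8 * (3 / 4) ^ (r - 1) := by
  induction r, hr using Nat.le_induction with
  | base => simp; positivity
  | succ r hr ih =>
    rw [sum_Ico_succ_top hr]
    have : ∀ t ∈ Ico 2 r, 3 / 12 ^ (r + 1 - t) * (3 / 4 : ℝ) ^ (t - 1) =
        1 / 12 * (3 / 12 ^ (r - t) * (3 / 4 : ℝ) ^ (t - 1)) := by
      intro t ht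
      rw [show r + 1 - t = r - t + 1 by have := (mem_Ico.1 ht).2; omega, pow_succ]
      field_simp
    rw [sum_congr rfl this, ← mul_sum, show r + 1 - r = 1 by omega,
      show r + 1 - 1 = r - 1 + 1 by omega, pow_succ (3 / 4 : ℝ), pow_one]
    linarith

theorem matchRate_two (N : ℕ) : matchRate N 2 = 3 / N := by
  simp [matchRate, numMatchings]

theorem matchRate_le_of_three_le {N t : ℕ} (hN : 8 ≤ N) (ht : 3 ≤ t) (htN : 2 * t ≤ N) :
    matchRate N t ≤ 5 / 8 * (3 / N) := by
  refine (matchRate_anti (by norm_num) ht htN).trans ?_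
  rw [matchRate_succ N (by norm_num : 1 ≤ 2), matchRate_two]
  have h8 : (8 : ℝ) ≤ N := by exact_mod_cast hN
  rw [mul_comm]
  refine mul_le_mul_of_nonneg_right ?_ (by positivity)
  rw [div_le_div_iff₀ (by positivity) (by norm_num)]
  norm_num
  linarith

/-- The recursion for the expected numbers of minimal zero sets preserves geometric decay. -/
theorem sum_matchRate_le {n N r : ℕ} {R : ℝ} (hn : (n : ℝ) ≤ R / 2) (hr : 2 ≤ r)
    (hrN : 2 * r ≤ N) (hN : 6 ≤ N → 8 ≤ N) :
    ∑ t ∈ Icc 2 r, (n.choose (2 * (r - t)) : ℝ) * 2 ^ (2 * (r - t) - 1) * matchRate N t *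
      ((3 / 4) ^ (t - 1) * R ^ (2 * (t - 1))) ≤
        (3 / 4) ^ (r - 1) * R ^ (2 * (r - 1)) * (3 / N) := by
  have hR : 0 ≤ R := by have : (0 : ℝ) ≤ n := n.cast_nonneg; linarith
  have hfirst : ∀ t, 2 ≤ t → t ≤ r → matchRate N t ≤ 3 / N := fun t ht htr => by
    rw [← matchRate_two]
    exact matchRate_anti (by norm_num) ht (by omega)
  have hterm : ∀ t ∈ Ico 2 r, (n.choose (2 * (r - t)) : ℝ) * 2 ^ (2 * (r - t) - 1) *
      matchRate N t * ((3 / 4) ^ (t - 1) * R ^ (2 * (t - 1))) ≤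
      3 / 12 ^ (r - t) * (3 / 4 : ℝ) ^ (t - 1) * (R ^ (2 * (r - 1)) * (3 / N)) := by
    intro t ht
    rw [mem_Ico] at ht
    calc _ ≤ 3 / 12 ^ (r - t) * R ^ (2 * (r - t)) * (3 / N) *
          ((3 / 4) ^ (t - 1) * R ^ (2 * (t - 1))) := by
          refine mul_le_mul_of_nonneg_right ?_ (by positivity)
          exact mul_le_mul (choose_even_mul_two_pow_le hn (by omega)) (hfirst t ht.1 ht.2.le)
            (matchRate_nonneg _ _) (by positivity)
      _ = _ := by
          rw [show 2 * (r - 1) = 2 * (r - t) + 2 * (t - 1) by omega, pow_add R]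
          ring
  rw [← Ico_insert_right hr, sum_insert right_notMem_Ico]
  have hsum := sum_le_sum hterm
  rw [← sum_mul] at hsum
  simp only [Nat.sub_self, mul_zero, Nat.choose_zero_right, Nat.cast_one, Nat.zero_sub, pow_zero,
    mul_one, one_mul]
  -- For r = 2 only t = 2 occurs, with rate exactly 3/N. For r ≥ 3 the term t = r takes 5/8 of the
  -- target and the smaller t take the remaining 3/8.
  rcases hr.eq_or_lt with rfl | hr3
  · simp only [Ico_self, sum_empty, add_zero]
    rw [matchRate_two, mul_comm]
  · have h1 := matchRate_le_of_three_le (hN (by omega)) hr3 hrN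
    have h2 := mul_le_mul_of_nonneg_right (sum_twelfth_pow_le hr)
      (show 0 ≤ R ^ (2 * (r - 1)) * (3 / (N : ℝ)) by positivity)
    have h3 := mul_le_mul_of_nonneg_right h1
      (show 0 ≤ (3 / 4 : ℝ) ^ (r - 1) * R ^ (2 * (r - 1)) by positivity)
    calc _ ≤ 5 / 8 * (3 / N) * ((3 / 4 : ℝ) ^ (r - 1) * R ^ (2 * (r - 1))) +
          3 / 8 * (3 / 4) ^ (r - 1) * (R ^ (2 * (r - 1)) * (3 / N)) :=
          add_le_add h3 (hsum.trans h2)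
      _ = _ := by ring

theorem sum_card_minZero_succ_le [NeZero c] (A : Finset (Key c k)) {r i : ℕ} (hi : i + 1 ≤ d)
    (hr : 2 * r ≤ Fintype.card (Bits k)) :
    (∑ T : Tables c d k l,
        #{Z ∈ powersetCard (2 * r) A | MinZero (fun x => derivedPrefix T x (i + 1) hi) Z} : ℝ) ≤
      ∑ t ∈ Icc 2 r, (#A).choose (2 * (r - t)) * 2 ^ (2 * (r - t) - 1) *
        matchRate (Fintype.card (Bits k)) t * ∑ T : Tables c d k l,
          (#{L ∈ powersetCard (2 * t) A |
            MinZero (fun x => derivedPrefix T x i (Nat.le_of_succ_le hi)) L} : ℝ) := by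
  have : NeZero (c + i) := ⟨by have := NeZero.pos c; omega⟩
  set G := Fintype.card (Fin (c + i) → Bits k → Bits k) with hG
  have hGpos : (0 : ℝ) < G := by exact_mod_cast Fintype.card_pos
  have hres := sum_sum_resample (Ω := Tables c d k l)
    (get := fun T => T.derive ⟨i, hi⟩) (set := fun T g => T.setDerive ⟨i, hi⟩ g)
    (fun T g => by simp [Tables.setDerive]) (fun T g g' => by simp [Tables.setDerive])
    (fun T => by simp [Tables.setDerive])
    (fun T => (#{Z ∈ powersetCard (2 * r) A |
      MinZero (fun x => derivedPrefix T x (i + 1) hi) Z} : ℝ))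
  refine le_of_mul_le_mul_left ?_ hGpos
  refine hres.symm.trans_le ?_
  simp only [derivedPrefix_succ_setDerive]
  refine (sum_le_sum fun T _ => sum_card_minZero_appendChar_le _
    (derivedPrefix_injective T i (Nat.le_of_succ_le hi)) A hr).trans ?_
  rw [← mul_sum, sum_comm]
  simp only [← mul_sum]
  exact le_rfl

theorem sum_card_minZero_le [NeZero c] (A : Finset (Key c k)) {R : ℝ} (hA : (#A : ℝ) ≤ R / 2)
    (hN : 6 ≤ Fintype.card (Bits k) → 8 ≤ Fintype.card (Bits k)) (i : ℕ) (hi : i ≤ d) {r : ℕ}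
    (hr : 2 ≤ r) (hrN : 2 * r ≤ Fintype.card (Bits k)) :
    (∑ T : Tables c d k l,
        #{Z ∈ powersetCard (2 * r) A | MinZero (fun x => derivedPrefix T x i hi) Z} : ℝ) ≤
      Fintype.card (Tables c d k l) * 3 ^ c * (3 / Fintype.card (Bits k) : ℝ) ^ i *
        ((3 / 4) ^ (r - 1) * R ^ (2 * (r - 1))) := by
  have hR : 0 ≤ R := by have : (0 : ℝ) ≤ #A := Nat.cast_nonneg _; linarith
  induction i generalizing r with
  | zero =>
    have h1 : ∀ T : Tables c d k l,
        (#{Z ∈ powersetCard (2 * r) A | MinZero (fun x => derivedPrefix T x 0 hi) Z} : ℝ) ≤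
          3 ^ c * ((3 / 4) ^ (r - 1) * R ^ (2 * (r - 1))) := by
      intro T
      obtain ⟨s, rfl⟩ := Nat.exists_eq_add_of_le' hr
      have h2 := card_isZero_le (derivedPrefix_injective T 0 hi) A (2 * s)
      have h3 : #{Z ∈ powersetCard (2 * (s + 2)) A | MinZero (fun x => derivedPrefix T x 0 hi) Z} ≤
          (#A) ^ (2 * s) * (3 ^ c * #A ^ 2) := by
        refine (card_le_card ?_).trans (h2.trans ?_)
        · intro Z hZ
          rw [mem_filter] at hZ ⊢
          exact ⟨hZ.1, hZ.2.2.1⟩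
        · rw [Fintype.card_fin]
          exact Nat.mul_le_mul_right _ (Nat.choose_le_pow _ _)
      calc _ ≤ (#A : ℝ) ^ (2 * s) * (3 ^ c * #A ^ 2) := by exact_mod_cast h3
        _ = 3 ^ c * (#A : ℝ) ^ (2 * (s + 1)) := by ring
        _ ≤ 3 ^ c * (R / 2) ^ (2 * (s + 1)) := by gcongr
        _ = 3 ^ c * ((1 / 4) ^ (s + 1) * R ^ (2 * (s + 1))) := by
          rw [div_pow, pow_mul 2, show (2 : ℝ) ^ 2 = 4 by norm_num, one_div_pow]; ring
        _ ≤ 3 ^ c * ((3 / 4) ^ (s + 1) * R ^ (2 * (s + 1))) := by gcongr; norm_num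
    refine (sum_le_sum fun T _ => h1 T).trans ?_
    rw [sum_const, card_univ, nsmul_eq_mul, pow_zero, mul_one, mul_assoc]
  | succ i ih =>
    set K : ℝ := Fintype.card (Tables c d k l) * 3 ^ c * (3 / Fintype.card (Bits k) : ℝ) ^ i with hK
    have hK0 : 0 ≤ K := by positivity
    refine (sum_card_minZero_succ_le A hi hrN).trans ?_
    calc _ ≤ ∑ t ∈ Icc 2 r, (#A).choose (2 * (r - t)) * 2 ^ (2 * (r - t) - 1) *
        matchRate (Fintype.card (Bits k)) t * (K * ((3 / 4) ^ (t - 1) * R ^ (2 * (t - 1)))) := by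
          refine sum_le_sum fun t ht => ?_
          rw [mem_Icc] at ht
          exact mul_le_mul_of_nonneg_left (ih (Nat.le_of_succ_le hi) ht.1 (by omega))
            (mul_nonneg (by positivity) (matchRate_nonneg _ _))
      _ = K * ∑ t ∈ Icc 2 r, (#A).choose (2 * (r - t)) * 2 ^ (2 * (r - t) - 1) *
        matchRate (Fintype.card (Bits k)) t * ((3 / 4) ^ (t - 1) * R ^ (2 * (t - 1))) := by
          rw [mul_sum]
          exact sum_congr rfl fun t _ => by ring
      _ ≤ K * ((3 / 4) ^ (r - 1) * R ^ (2 * (r - 1)) * (3 / Fintype.card (Bits k))) :=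
          mul_le_mul_of_nonneg_left (sum_matchRate_le hA hr hrN hN) hK0
      _ = _ := by rw [hK, pow_succ]; ring

end Levels

/-! ### Keys that share a bin under `hbar` -/

section Bins

open Finset
open scoped Classical

variable {c e k l : ℕ}

theorem derivedPrefix_congr_top {d : ℕ} (T : Tables c d k l) (t : Fin (c + d) → Bits k → Bits l)
    (x : Key c k) (j : ℕ) (hj : j ≤ d) :
    derivedPrefix { T with top := t } x j hj = derivedPrefix T x j hj := by
  induction j with
  | zero => rfl
  | succ j ih =>
    simp only [derivedPrefix]
    rw [ih]

/-- The tables that compute `hbar` from the derived key without its last character. -/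
def Tables.penultimate (T : Tables c (e + 1) k l) : Fin (c + e) → Bits k → Bits l × Bits k :=
  fun j a => (T.top (Fin.castSucc (n := c + e) j) a, T.derive (Fin.last e) j a)

/-- Replace the tables that compute `hbar` from the derived key without its last character. -/
def Tables.setPenultimate (T : Tables c (e + 1) k l)
    (g : Fin (c + e) → Bits k → Bits l × Bits k) : Tables c (e + 1) k l :=
  { T.setDerive (Fin.last e) fun j a => (g j a).2 with
    top := Fin.snoc (n := c + e) (α := fun _ => Bits k → Bits l) (fun j a => (g j a).1)
      (T.top (Fin.last (c + e))) }

theorem penultimate_setPenultimate (T : Tables c (e + 1) k l)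
    (g : Fin (c + e) → Bits k → Bits l × Bits k) : (T.setPenultimate g).penultimate = g := by
  funext j a
  simp [Tables.penultimate, Tables.setPenultimate, Tables.setDerive]

theorem setPenultimate_setPenultimate (T : Tables c (e + 1) k l)
    (g g' : Fin (c + e) → Bits k → Bits l × Bits k) :
    (T.setPenultimate g).setPenultimate g' = T.setPenultimate g' := by
  simp [Tables.setPenultimate, Tables.setDerive]

theorem setPenultimate_penultimate (T : Tables c (e + 1) k l) :
    T.setPenultimate T.penultimate = T := by
  refine Tables.ext rfl ?_ ?_
  · exact Function.update_eq_self _ _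
  · exact Fin.snoc_init_self (n := c + e) (α := fun _ => Bits k → Bits l) T.top

theorem derivedPrefix_setPenultimate (T : Tables c (e + 1) k l)
    (g : Fin (c + e) → Bits k → Bits l × Bits k) (x : Key c k) :
    derivedPrefix (T.setPenultimate g) x e (Nat.le_succ e) =
      derivedPrefix T x e (Nat.le_succ e) := by
  rw [Tables.setPenultimate, derivedPrefix_congr_top]
  exact derivedPrefix_setDerive T (Fin.last e) _ x e _ le_rfl

theorem hbar_eq_tabulate [NeZero c] (T : Tables c (e + 1) k l) (x : Key c k) :
    hbar T x = tabulate T.penultimate (derivedPrefix T x e (Nat.le_succ e)) := by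
  have hlast : lastPos c (e + 1) = Fin.last (c + e) := Fin.ext (by simp [lastPos])
  have hkey : derivedKey T x = Fin.snoc (n := c + e) (α := fun _ => Bits k)
      (derivedPrefix T x e (Nat.le_succ e))
      (simpleTab (T.derive (Fin.last e)) (derivedPrefix T x e (Nat.le_succ e))) := rfl
  have herase : (univ : Finset (Fin (c + e + 1))).erase (Fin.last (c + e)) =
      univ.map Fin.castSuccEmb := by
    ext j
    refine Fin.lastCases ?_ (fun j => ?_) j
    · simp
    · simp
  ext1
  · simp only [hbar, hlast]
    change ∑ j ∈ (univ : Finset (Fin (c + e + 1))).erase (Fin.last (c + e)), _ = _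
    rw [herase, sum_map, tabulate, Prod.fst_sum]
    refine sum_congr rfl fun j _ => ?_
    rw [hkey]
    simp [Tables.penultimate]
  · simp only [hbar, hlast]
    rw [hkey, Fin.snoc_last, tabulate, Prod.snd_sum]
    rfl

theorem hbar_setPenultimate [NeZero c] (T : Tables c (e + 1) k l)
    (g : Fin (c + e) → Bits k → Bits l × Bits k) (x : Key c k) :
    hbar (T.setPenultimate g) x = tabulate g (derivedPrefix T x e (Nat.le_succ e)) := by
  rw [hbar_eq_tabulate, penultimate_setPenultimate, derivedPrefix_setPenultimate]

/-- A key with value `z` under `hbar` lies in the bin `(α, w)` if its last derived character is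
`α`, and it is selected when the last table maps `α` to `w` on the selection bits. -/
def InBin (sel : Finset (Fin l)) (mask : Key c k → Bits l) (α : Bits k) (w : sel → ZMod 2)
    (x : Key c k) (z : Bits l × Bits k) : Prop :=
  z.2 = α ∧ ∀ b : sel, z.1 b + w b = mask x b

/-- All keys of `V` lie in the same bin. -/
def SameBin (sel : Finset (Fin l)) (mask : Key c k → Bits l) (h : Key c k → Bits l × Bits k)
    (V : Finset (Key c k)) : Prop :=
  ∃ α w, ∀ x ∈ V, InBin sel mask α w x (h x)

theorem card_bits (k : ℕ) : Fintype.card (Bits k) = 2 ^ k := by simp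

theorem card_inBin_mul (sel : Finset (Fin l)) (mask : Key c k → Bits l) (α : Bits k)
    (w : sel → ZMod 2) (x : Key c k) :
    #{z | InBin sel mask α w x z} * (2 ^ #sel * Fintype.card (Bits k)) =
      Fintype.card (Bits l × Bits k) := by
  have h : ({z | InBin sel mask α w x z} : Finset (Bits l × Bits k)) =
      Fintype.piFinset (fun b : Fin l => if h : b ∈ sel then {mask x b - w ⟨b, h⟩} else univ) ×ˢ
        {α} := by
    ext z
    simp only [mem_filter, mem_univ, true_and, mem_product, mem_singleton, Fintype.mem_piFinset]
    rw [InBin, and_comm]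
    refine and_congr_left fun _ => ?_
    constructor
    · intro hz b
      by_cases hb : b ∈ sel
      · simp [hb, ← hz ⟨b, hb⟩]
      · simp [hb]
    · intro hz b
      have := hz b
      simp only [b.2, dif_pos, mem_singleton] at this
      rw [this]
      exact sub_add_cancel _ _
  have hprod : ∀ b : Fin l, #(if h : b ∈ sel then {mask x b - w ⟨b, h⟩} else (univ : Finset (ZMod 2)))
      = if b ∈ sel then 1 else 2 := by
    intro b
    by_cases hb : b ∈ sel
    · simp [hb]
    · simp [hb, ZMod.card]
  rw [h, card_product, Fintype.card_piFinset, card_singleton, mul_one, Fintype.card_prod,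
    card_bits l, ← mul_assoc]
  congr 1
  rw [prod_congr rfl fun b _ => hprod b, prod_ite, prod_const_one, one_mul, prod_const, ← pow_add]
  congr 1
  have := card_filter_add_card_filter_not (s := (univ : Finset (Fin l))) (fun b => b ∈ sel)
  simp only [card_univ, Fintype.card_fin, filter_univ_mem] at this
  omega

theorem Indep.card_inBin_tabulate {m : ℕ} {p : Key c k → Fin m → Bits k} {V : Finset (Key c k)}
    (h : Indep p V) (sel : Finset (Fin l)) (mask : Key c k → Bits l) (α : Bits k)
    (w : sel → ZMod 2) :
    #{g : Fin m → Bits k → Bits l × Bits k | ∀ x ∈ V, InBin sel mask α w x (tabulate g (p x))} *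
      (2 ^ #sel * Fintype.card (Bits k)) ^ #V =
        Fintype.card (Fin m → Bits k → Bits l × Bits k) := by
  set R := 2 ^ #sel * Fintype.card (Bits k) with hR
  have hRpos : 0 < R := by positivity
  let B : Finset (V → Bits l × Bits k) :=
    Fintype.piFinset fun x : V => {z | InBin sel mask α w x z}
  have hB : #B * R ^ #V = Fintype.card (Bits l × Bits k) ^ #V := by
    rw [Fintype.card_piFinset]
    calc _ = ∏ x : V, (#{z | InBin sel mask α w x z} * R) := by
          rw [prod_mul_distrib, prod_const, card_univ, Fintype.card_coe]
      _ = _ := by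
          simp only [hR, card_inBin_mul, prod_const, card_univ, Fintype.card_coe]
  have hBpos : 0 < #B := by
    refine Nat.pos_of_ne_zero fun h0 => ?_
    rw [h0, zero_mul] at hB
    exact (pow_pos (Fintype.card_pos (α := Bits l × Bits k)) #V).ne hB
  have h1 : #{g : Fin m → Bits k → Bits l × Bits k | (fun x : V => tabulate g (p x)) ∈ B} *
      Fintype.card (Bits l × Bits k) ^ #V =
        #B * Fintype.card (Fin m → Bits k → Bits l × Bits k) := by
    convert h.card_tabulate_mem B
  have h2 : ({g : Fin m → Bits k → Bits l × Bits k |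
      ∀ x ∈ V, InBin sel mask α w x (tabulate g (p x))} : Finset (Fin m → Bits k → Bits l × Bits k)) =
      ({g | (fun x : V => tabulate g (p x)) ∈ B} : Finset (Fin m → Bits k → Bits l × Bits k)) := by
    ext g
    simp [B]
  rw [h2]
  refine Nat.eq_of_mul_eq_mul_left hBpos ?_
  rw [← h1, ← hB]
  ring

/-- Each of the R bins receives all v + 1 keys with probability R^(-(v+1)). -/
theorem Indep.card_sameBin_tabulate_le {m : ℕ} {p : Key c k → Fin m → Bits k}
    {V : Finset (Key c k)} (h : Indep p V) (sel : Finset (Fin l)) (mask : Key c k → Bits l)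
    {v : ℕ} (hv : #V = v + 1) :
    #{g : Fin m → Bits k → Bits l × Bits k | SameBin sel mask (fun x => tabulate g (p x)) V} *
      (2 ^ #sel * Fintype.card (Bits k)) ^ v ≤
        Fintype.card (Fin m → Bits k → Bits l × Bits k) := by
  set R := 2 ^ #sel * Fintype.card (Bits k) with hR
  have hRpos : 0 < R := by positivity
  set G := Fintype.card (Fin m → Bits k → Bits l × Bits k)
  have hsub : ({g : Fin m → Bits k → Bits l × Bits k |
      SameBin sel mask (fun x => tabulate g (p x)) V} : Finset _) ⊆
      (univ : Finset (Bits k × (sel → ZMod 2))).biUnion fun q =>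
        {g | ∀ x ∈ V, InBin sel mask q.1 q.2 x (tabulate g (p x))} := by
    intro g hg
    obtain ⟨α, w, hg⟩ := (mem_filter.1 hg).2
    simp only [mem_biUnion, mem_filter, mem_univ, true_and]
    exact ⟨(α, w), hg⟩
  refine Nat.le_of_mul_le_mul_right ?_ hRpos
  calc _ = #{g : Fin m → Bits k → Bits l × Bits k |
        SameBin sel mask (fun x => tabulate g (p x)) V} * R ^ #V := by rw [hv, pow_succ]; ring
    _ ≤ (∑ q : Bits k × (sel → ZMod 2), #{g : Fin m → Bits k → Bits l × Bits k |
        ∀ x ∈ V, InBin sel mask q.1 q.2 x (tabulate g (p x))}) * R ^ #V :=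
        Nat.mul_le_mul_right _ ((card_le_card hsub).trans card_biUnion_le)
    _ = ∑ q : Bits k × (sel → ZMod 2), G := by
        rw [sum_mul]
        exact sum_congr rfl fun q _ => h.card_inBin_tabulate sel mask q.1 q.2
    _ = G * R := by
        rw [sum_const, card_univ, Fintype.card_prod, Fintype.card_fun (α := sel), Fintype.card_coe,
          ZMod.card, smul_eq_mul, hR]
        ring

variable [NeZero c]

/-- `good` depends only on the derived prefix, so the tables of `hbar` can be resampled while the
good sets stay fixed. It is used for independent sets and for minimal zero sets. -/
theorem sum_card_sameBin_le (sel : Finset (Fin l)) (mask : Key c k → Bits l)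
    (good : (Key c k → Fin (c + e) → Bits k) → Finset (Key c k) → Prop) {v : ℕ}
    (𝒮 : Finset (Finset (Key c k)))
    (hgood : ∀ p, ∀ V ∈ 𝒮, good p V → ∃ V' ⊆ V, Indep p V' ∧ #V' = v + 1) :
    (∑ T : Tables c (e + 1) k l, #{V ∈ 𝒮 |
        good (fun x => derivedPrefix T x e (Nat.le_succ e)) V ∧ SameBin sel mask (hbar T) V} : ℝ) ≤
      (∑ T : Tables c (e + 1) k l, #{V ∈ 𝒮 |
        good (fun x => derivedPrefix T x e (Nat.le_succ e)) V} : ℝ) /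
          (2 ^ #sel * Fintype.card (Bits k)) ^ v := by
  set G := Fintype.card (Fin (c + e) → Bits k → Bits l × Bits k) with hG
  have hGpos : (0 : ℝ) < G := by exact_mod_cast Fintype.card_pos
  have hRpos : (0 : ℝ) < (2 ^ #sel * Fintype.card (Bits k)) ^ v := by
    have : (0 : ℝ) < Fintype.card (Bits k) := by exact_mod_cast Fintype.card_pos
    positivity
  have hres := sum_sum_resample (Ω := Tables c (e + 1) k l) penultimate_setPenultimate
    setPenultimate_setPenultimate setPenultimate_penultimate
    (fun T => (#{V ∈ 𝒮 |
        good (fun x => derivedPrefix T x e (Nat.le_succ e)) V ∧ SameBin sel mask (hbar T) V} : ℝ))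
  refine le_of_mul_le_mul_left ?_ hGpos
  refine hres.symm.trans_le ?_
  rw [mul_div_assoc', mul_sum, sum_div]
  refine sum_le_sum fun T _ => ?_
  have hfun : ∀ g, hbar (T.setPenultimate g) =
      fun x => tabulate g (derivedPrefix T x e (Nat.le_succ e)) :=
    fun g => funext (hbar_setPenultimate T g)
  simp only [derivedPrefix_setPenultimate, hfun]
  set p : Key c k → Fin (c + e) → Bits k := fun x => derivedPrefix T x e (Nat.le_succ e)
  calc (∑ g : Fin (c + e) → Bits k → Bits l × Bits k,
        (#{V ∈ 𝒮 | good p V ∧ SameBin sel mask (fun x => tabulate g (p x)) V} : ℝ))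
      = ∑ V ∈ 𝒮 with good p V, (#{g : Fin (c + e) → Bits k → Bits l × Bits k |
          SameBin sel mask (fun x => tabulate g (p x)) V} : ℝ) := by
        simp only [← filter_filter, card_filter _ (filter _ _), card_filter _ univ, Nat.cast_sum]
        rw [sum_comm]
    _ ≤ ∑ V ∈ 𝒮 with good p V, (G : ℝ) / (2 ^ #sel * Fintype.card (Bits k)) ^ v := by
        refine sum_le_sum fun V hV => ?_
        obtain ⟨V', hV', hind, hcard⟩ := hgood p V (mem_filter.1 hV).1 (mem_filter.1 hV).2
        rw [le_div_iff₀ hRpos]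
        have h1 := hind.card_sameBin_tabulate_le sel mask hcard
        have h2 : #{g : Fin (c + e) → Bits k → Bits l × Bits k |
            SameBin sel mask (fun x => tabulate g (p x)) V} ≤
            #{g : Fin (c + e) → Bits k → Bits l × Bits k |
            SameBin sel mask (fun x => tabulate g (p x)) V'} := by
          refine card_le_card (monotone_filter_right _ ?_)
          rintro g - ⟨α, w, h⟩
          exact ⟨α, w, fun x hx => h x (hV' hx)⟩
        exact_mod_cast (Nat.mul_le_mul_right _ h2).trans h1
    _ = _ := by rw [sum_const, nsmul_eq_mul]; ring

theorem sum_geometric_le (r : ℕ) : ∑ t ∈ Icc 2 r, (3 / 4 : ℝ) ^ (t - 1) ≤ 3 := by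
  have key : ∀ n : ℕ, ∑ t ∈ Ico 2 (n + 2), (3 / 4 : ℝ) ^ (t - 1) ≤ 3 - 3 * (3 / 4) ^ n := by
    intro n
    induction n with
    | zero => simp
    | succ n ih =>
      rw [show n + 1 + 2 = n + 2 + 1 by ring, sum_Ico_succ_top (by omega),
        show n + 2 - 1 = n + 1 by omega, pow_succ]
      linarith
  refine (sum_le_sum_of_subset_of_nonneg (t := Ico 2 (r + 2)) ?_ fun _ _ _ => by positivity).trans
    ((key r).trans ?_)
  · intro t ht
    rw [mem_Icc] at ht
    rw [mem_Ico]
    omega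
  · have : (0 : ℝ) ≤ (3 / 4) ^ r := by positivity
    linarith

/-- The number of tables for which some bin contains at least `i` keys. -/
theorem card_large_bin_le (A : Finset (Key c k)) (sel : Finset (Fin l)) (mask : Key c k → Bits l)
    (hA : (#A : ℝ) ≤ 2 ^ #sel * Fintype.card (Bits k) / 2)
    (hN : 6 ≤ Fintype.card (Bits k) → 8 ≤ Fintype.card (Bits k)) {i : ℕ}
    (hiN : i + 1 ≤ Fintype.card (Bits k)) :
    (#{T : Tables c (e + 1) k l | ∃ α w, i + 1 ≤ #{x ∈ A | InBin sel mask α w x (hbar T x)}} : ℝ) ≤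
      Fintype.card (Tables c (e + 1) k l) *
        (2 ^ #sel * Fintype.card (Bits k) / (2 ^ (i + 1) * (i + 1).factorial) +
          3 ^ (c + 1) * (3 / Fintype.card (Bits k) : ℝ) ^ e) := by
  set N := Fintype.card (Bits k) with hNdef
  set R : ℝ := 2 ^ #sel * N with hR
  set U := Fintype.card (Tables c (e + 1) k l)
  have hNpos : (0 : ℝ) < N := by exact_mod_cast Fintype.card_pos
  have hRpos : 0 < R := by positivity
  have : NeZero (c + e) := ⟨by have := NeZero.pos c; omega⟩
  let p : Tables c (e + 1) k l → Key c k → Fin (c + e) → Bits k :=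
    fun T x => derivedPrefix T x e (Nat.le_succ e)
  have hpoint : ∀ T : Tables c (e + 1) k l,
      (if ∃ α w, i + 1 ≤ #{x ∈ A | InBin sel mask α w x (hbar T x)} then 1 else 0 : ℕ) ≤
      #{V ∈ powersetCard (i + 1) A | Indep (p T) V ∧ SameBin sel mask (hbar T) V} +
        ∑ t ∈ Icc 2 ((i + 1) / 2),
          #{L ∈ powersetCard (2 * t) A | MinZero (p T) L ∧ SameBin sel mask (hbar T) L} := by
    intro T
    split_ifs with h
    swap
    · exact Nat.zero_le _
    obtain ⟨α, w, h⟩ := h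
    obtain ⟨V, hV, hVc⟩ := exists_subset_card_eq h
    have hVA : V ⊆ A := hV.trans (filter_subset _ _)
    have hsame : ∀ V' ⊆ V, SameBin sel mask (hbar T) V' := fun V' hV' =>
      ⟨α, w, fun x hx => (mem_filter.1 (hV (hV' hx))).2⟩
    by_cases hind : Indep (p T) V
    · refine le_add_right (card_pos.2 ⟨V, ?_⟩)
      exact mem_filter.2 ⟨mem_powersetCard.2 ⟨hVA, hVc⟩, hind, hsame V (Subset.refl _)⟩
    · obtain ⟨L, hLV, hL⟩ := exists_minZero_of_not_indep hind
      have h4 := hL.four_le_card (derivedPrefix_injective T e (Nat.le_succ e))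
      obtain ⟨t, ht⟩ := hL.2.1.even_card
      have hLc := card_le_card hLV
      refine le_add_left (le_trans ?_ (single_le_sum (f := fun t =>
        #{L ∈ powersetCard (2 * t) A | MinZero (p T) L ∧ SameBin sel mask (hbar T) L})
        (fun _ _ => Nat.zero_le _) (a := t) (mem_Icc.2 (by omega))))
      refine card_pos.2 ⟨L, mem_filter.2 ⟨mem_powersetCard.2 ⟨hLV.trans hVA, by omega⟩, hL,
        hsame L hLV⟩⟩
  have hind : (∑ T : Tables c (e + 1) k l,
      #{V ∈ powersetCard (i + 1) A | Indep (p T) V ∧ SameBin sel mask (hbar T) V} : ℝ) ≤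
      U * (R / (2 ^ (i + 1) * (i + 1).factorial)) := by
    refine (sum_card_sameBin_le (e := e) sel mask Indep (v := i) (powersetCard (i + 1) A)
      fun p V hV h => ⟨V, Subset.refl _, h, (mem_powersetCard.1 hV).2⟩).trans ?_
    calc _ ≤ (∑ T : Tables c (e + 1) k l, (R / 2) ^ (i + 1) / (i + 1).factorial) / R ^ i := by
            refine div_le_div_of_nonneg_right (sum_le_sum fun T _ => ?_) (by positivity)
            calc _ ≤ ((#A).choose (i + 1) : ℝ) := by
                  rw [← card_powersetCard]
                  exact_mod_cast card_filter_le _ _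
              _ ≤ (#A : ℝ) ^ (i + 1) / (i + 1).factorial := Nat.choose_le_pow_div _ _
              _ ≤ _ := by gcongr
        _ = _ := by
            rw [sum_const, card_univ, nsmul_eq_mul, div_pow, pow_succ R]
            field_simp
            rfl
  have hzero : ∀ t ∈ Icc 2 ((i + 1) / 2), (∑ T : Tables c (e + 1) k l,
      #{L ∈ powersetCard (2 * t) A | MinZero (p T) L ∧ SameBin sel mask (hbar T) L} : ℝ) ≤
      U * 3 ^ c * (3 / N : ℝ) ^ e * (3 / 4) ^ (t - 1) := by
    intro t ht
    rw [mem_Icc] at ht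
    refine (sum_card_sameBin_le (e := e) sel mask MinZero (v := 2 * (t - 1))
      (powersetCard (2 * t) A) ?_).trans ?_
    · intro p V hVc hV
      obtain ⟨x, hx⟩ := hV.1
      -- The 2t - 1 remaining keys are independent, so v = 2(t - 1).
      refine ⟨V.erase x, erase_subset _ _, hV.indep_erase hx, ?_⟩
      rw [card_erase_of_mem hx, (mem_powersetCard.1 hVc).2]
      omega
    · rw [div_le_iff₀ (by positivity)]
      refine (sum_card_minZero_le A hA hN e (Nat.le_succ e) ht.1 (by omega)).trans_eq ?_
      ring
  calc (#{T : Tables c (e + 1) k l |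
        ∃ α w, i + 1 ≤ #{x ∈ A | InBin sel mask α w x (hbar T x)}} : ℝ)
      ≤ ∑ T : Tables c (e + 1) k l,
        ((#{V ∈ powersetCard (i + 1) A | Indep (p T) V ∧ SameBin sel mask (hbar T) V} : ℝ) +
        ∑ t ∈ Icc 2 ((i + 1) / 2),
          (#{L ∈ powersetCard (2 * t) A | MinZero (p T) L ∧ SameBin sel mask (hbar T) L} : ℝ)) := by
        rw [card_filter, Nat.cast_sum]
        refine sum_le_sum fun T _ => ?_
        exact_mod_cast hpoint T
    _ ≤ U * (R / (2 ^ (i + 1) * (i + 1).factorial)) +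
        ∑ t ∈ Icc 2 ((i + 1) / 2), U * 3 ^ c * (3 / N : ℝ) ^ e * (3 / 4) ^ (t - 1) := by
        rw [sum_add_distrib, sum_comm]
        exact add_le_add hind (sum_le_sum hzero)
    _ ≤ U * (R / (2 ^ (i + 1) * (i + 1).factorial)) + U * 3 ^ c * (3 / N : ℝ) ^ e * 3 := by
        rw [← mul_sum]
        have := sum_geometric_le ((i + 1) / 2)
        gcongr
    _ = _ := by ring

end Bins

/-! ### From conditional expectations to bins, and the choice of the bin size -/

section Probability

open scoped Classical

variable {c d k l : ℕ}

theorem law_singleton_ne_zero (T : Tables c d k l) : law c d k l {T} ≠ 0 := by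
  rw [law, Ne, uniformOn_eq_zero_iff Set.finite_univ]
  simp

/-- Every single outcome has positive mass. -/
theorem forall_of_ae_law {P : Tables c d k l → Prop} (h : ∀ᵐ T ∂law c d k l, P T) (T) : P T := by
  by_contra hT
  refine law_singleton_ne_zero T (measure_mono_null ?_ (ae_iff.1 h))
  rintro _ rfl
  exact hT

theorem law_real_setOf (P : Tables c d k l → Prop) [DecidablePred P] :
    (law c d k l).real {T | P T} =
      ((Finset.univ.filter P).card : ℝ) / Fintype.card (Tables c d k l) := by
  have hS : {T | P T} = ((Finset.univ.filter P : Finset (Tables c d k l)) : Set _) := by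
    ext; simp
  rw [hS, Measure.real, law, uniformOn_univ, Measure.count_apply_finset, ENNReal.toReal_div]
  simp

variable [NeZero c]

theorem condLayer_eq_zero_of_card_lt (A : Finset (Key c k)) (sel : Finset (Fin l))
    (mask : Key c k → Bits l) {i : ℕ} (hi : A.card < i) (T : Tables c d k l) :
    condLayer A sel mask i T = 0 := by
  have h : (fun T : Tables c d k l => (layer A sel mask i T : ℝ)) = 0 := by
    funext T
    simp only [layer, Pi.zero_apply, Nat.cast_eq_zero, Finset.card_eq_zero,
      Finset.filter_eq_empty_iff, Finset.mem_univ, true_implies, not_le]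
    intro α
    refine lt_of_le_of_lt (Finset.card_le_card ?_) hi
    exact (Finset.filter_subset _ _).trans (Finset.filter_subset _ _)
  rw [condLayer, h, condExp_zero]
  rfl

/-- If the layer vanished on the whole fibre of `hbar` through T, so would its conditional
expectation there. -/
theorem exists_layer_pos_of_condLayer_pos (A : Finset (Key c k)) (sel : Finset (Fin l))
    (mask : Key c k → Bits l) (i : ℕ) (T : Tables c d k l) (h : 0 < condLayer A sel mask i T) :
    ∃ T' : Tables c d k l, hbar T' = hbar T ∧ 0 < layer A sel mask i T' := by
  by_contra! hc
  let m : MeasurableSpace (Tables c d k l) :=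
    MeasurableSpace.comap (fun (T : Tables c d k l) (x : Key c k) => hbar T x) ⊤
  let s : Set (Tables c d k l) := (fun T' x => hbar T' x) ⁻¹' {fun x => hbar T x}
  have hs : MeasurableSet[m] s := ⟨{fun x => hbar T x}, trivial, rfl⟩
  have hint : Integrable (fun T : Tables c d k l => (layer A sel mask i T : ℝ)) (law c d k l) :=
    Integrable.of_finite
  have h1 := condExp_indicator (m := m) hint hs
  have h2 : s.indicator (fun T : Tables c d k l => (layer A sel mask i T : ℝ)) = 0 := by
    funext T'
    by_cases hT' : T' ∈ s
    · rw [Set.indicator_of_mem hT']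
      have := hc T' hT'
      simp only [Pi.zero_apply]
      exact_mod_cast Nat.le_zero.1 this
    · rw [Set.indicator_of_notMem hT']; rfl
  rw [h2, condExp_zero] at h1
  have h3 := forall_of_ae_law h1 T
  rw [Set.indicator_of_mem (show T ∈ s from rfl)] at h3
  exact h.ne h3

theorem exists_large_bin_of_layer_pos (A : Finset (Key c k)) (sel : Finset (Fin l))
    (mask : Key c k → Bits l) (i : ℕ) (T : Tables c d k l) (h : 0 < layer A sel mask i T) :
    ∃ α w, i ≤ (A.filter fun x => InBin sel mask α w x (hbar T x)).card := by
  obtain ⟨α, hα⟩ := Finset.card_pos.1 h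
  -- The witness w consists of the selection bits of the last table at α.
  refine ⟨α, fun b => T.top (lastPos c d) α b, (Finset.mem_filter.1 hα).2.trans
    (Finset.card_le_card fun x hx => ?_)⟩
  simp only [bucket, selected, Finset.mem_filter] at hx
  rw [Finset.mem_filter]
  refine ⟨hx.1.1, hx.2, fun b => ?_⟩
  rw [← hx.1.2 b b.2, hash_eq_hbar]
  have : (hbar T x).2 = α := hx.2
  rw [this]
  rfl

/-- The bound fails at i = 1; it holds at i = 2 since e² < 8, and then e ≤ 2(i + 1) carries it on.
-/
theorem exp_le_two_pow_mul_factorial {i : ℕ} (hi : 2 ≤ i) :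
    Real.exp i ≤ 2 ^ i * i.factorial := by
  have he := Real.exp_one_lt_d9
  have he0 := Real.exp_pos 1
  induction i, hi using Nat.le_induction with
  | base =>
    rw [show ((2 : ℕ) : ℝ) = 1 + 1 by norm_num, Real.exp_add]
    norm_num
    nlinarith
  | succ i hi ih =>
    have h2 : (2 : ℝ) ≤ i := by exact_mod_cast hi
    rw [Nat.cast_add_one, Real.exp_add, pow_succ, Nat.factorial_succ]
    push_cast
    calc Real.exp i * Real.exp 1 ≤ (2 ^ i * i.factorial) * (2 * (i + 1)) := by
          refine mul_le_mul ih ?_ he0.le (by positivity)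
          linarith
      _ = _ := by ring

theorem pow_half_le_factorial (M : ℕ) : M ^ M ≤ (2 * M).factorial := by
  calc M ^ M ≤ (M + 1) ^ M := Nat.pow_le_pow_left (Nat.le_succ M) M
    _ ≤ M.factorial * (M + 1) ^ M := Nat.le_mul_of_pos_left _ M.factorial_pos
    _ ≤ (M + M).factorial := Nat.factorial_mul_pow_le_factorial
    _ = _ := by rw [two_mul]

theorem alphabetSize_eq (k : ℕ) : alphabetSize k = 2 ^ k := by
  rw [alphabetSize, card_bits]
  norm_num

theorem four_le_alphabetSize {k : ℕ} (hk : 2 ≤ k) : 4 ≤ alphabetSize k := by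
  rw [alphabetSize_eq, show (4 : ℝ) = 2 ^ 2 by norm_num]
  exact pow_le_pow_right₀ (by norm_num) hk

theorem iMax_add_two (k f s : ℕ) :
    iMax k (f + 2) s = Real.log (alphabetSize k ^ f * 2 ^ s) := by
  rw [iMax, ← zpow_natCast (alphabetSize k) f]
  congr 4
  push_cast
  ring

theorem one_le_iMax {k f s : ℕ} (hk : 2 ≤ k) (hf : 1 ≤ f) : 1 ≤ iMax k (f + 2) s := by
  have hN4 := four_le_alphabetSize hk
  have hN0 : 0 < alphabetSize k := by linarith
  rw [iMax_add_two, Real.le_log_iff_exp_le (by positivity)]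
  have h1 : (4 : ℝ) ≤ alphabetSize k ^ f := hN4.trans (le_self_pow₀ (by linarith) (by omega))
  have h2 : (1 : ℝ) ≤ 2 ^ s := one_le_pow₀ (by norm_num)
  have := Real.exp_one_lt_d9
  nlinarith

/-- The fully random part of the failure probability. -/
theorem independent_bin_bound {k e s : ℕ} (hk : 2 ≤ k) (he : 3 ≤ e)
    (hsk : (s : ℝ) ≤ alphabetSize k / 2) :
    ∃ i, i ≤ ⌊iMax k (e + 1) s⌋₊ ∧ i + 1 ≤ Fintype.card (Bits k) ∧
      2 ^ s * alphabetSize k / (2 ^ (i + 1) * (i + 1).factorial) ≤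
        (1 / alphabetSize k) ^ (((e + 1 : ℕ) : ℤ) - 3) +
          (1 / alphabetSize k) ^ (alphabetSize k / 2 - 1) := by
  obtain ⟨f, rfl⟩ := Nat.exists_eq_add_of_le' he
  set N := alphabetSize k with hN
  have hN4 : 4 ≤ N := four_le_alphabetSize hk
  have hN0 : 0 < N := by linarith
  set i := ⌊iMax k (f + 3 + 1) s⌋₊ with hi
  have hQ : iMax k (f + 3 + 1) s = Real.log (N ^ (f + 2) * 2 ^ s) := iMax_add_two k (f + 2) s
  have hz : (1 / N) ^ (((f + 3 + 1 : ℕ) : ℤ) - 3) = (1 / N) ^ (f + 1) := by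
    rw [← zpow_natCast]
    congr 1
    push_cast
    ring
  rw [hz]
  -- If the threshold is below N, then 2^(i+1) (i+1)! ≥ exp(i+1) ≥ N^(d-2) 2^s. Otherwise i + 1 is
  -- capped at N = 2M, where s ≤ M and M^M ≤ (2M)! give the term with exponent N/2 - 1.
  by_cases hiN : i + 1 ≤ Fintype.card (Bits k)
  · refine ⟨i, le_rfl, hiN, ?_⟩
    have hQ0 : 0 < N ^ (f + 2) * 2 ^ s := by positivity
    have hone : 1 ≤ iMax k (f + 3 + 1) s := one_le_iMax hk (Nat.le_add_left 1 (f + 1))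
    have h2i : 2 ≤ i + 1 := by
      have : 1 ≤ i := (Nat.one_le_floor_iff _).2 hone
      omega
    have hle : N ^ (f + 2) * 2 ^ s ≤ 2 ^ (i + 1) * (i + 1).factorial := by
      refine le_trans ?_ (exp_le_two_pow_mul_factorial h2i)
      rw [← Real.log_le_iff_le_exp hQ0, ← hQ]
      push_cast
      exact (Nat.lt_floor_add_one _).le
    calc _ ≤ 2 ^ s * N / (N ^ (f + 2) * 2 ^ s) := by gcongr
      _ = (1 / N) ^ (f + 1) := by
          rw [one_div_pow, pow_succ N (f + 1)]
          field_simp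
      _ ≤ _ := le_add_of_nonneg_right (Real.rpow_nonneg (by positivity) _)
  · obtain ⟨j, rfl⟩ := Nat.exists_eq_add_of_le' (show 1 ≤ k by omega)
    set M := 2 ^ j with hM
    have hcard : Fintype.card (Bits (j + 1)) = 2 * M := by rw [card_bits, hM, pow_succ, mul_comm]
    have hNM : N = 2 * M := by rw [hN, alphabetSize, hcard]; push_cast; ring
    have hM2 : 2 ≤ M := by
      have : (2 : ℝ) ≤ M := by linarith
      exact_mod_cast this
    have hsM : s ≤ M := by
      have : (s : ℝ) ≤ M := by rw [hNM] at hsk; linarith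
      exact_mod_cast this
    refine ⟨2 * M - 1, by omega, by omega, ?_⟩
    rw [Nat.sub_add_cancel (by omega)]
    have hfac : (M : ℝ) ^ M ≤ (2 * M).factorial := by exact_mod_cast pow_half_le_factorial M
    have hM0 : (0 : ℝ) < M := by exact_mod_cast (by omega : 0 < M)
    have hle : 2 ^ s * N ^ M ≤ 2 ^ (2 * M) * (2 * M).factorial := by
      calc 2 ^ s * N ^ M = 2 ^ s * 2 ^ M * (M : ℝ) ^ M := by rw [hNM, mul_pow]; ring
        _ ≤ 2 ^ M * 2 ^ M * (2 * M).factorial := by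
            gcongr
            norm_num
        _ = _ := by rw [two_mul M, pow_add]
    have hexp : (1 / N) ^ (N / 2 - 1) = (1 / N) ^ (M - 1) := by
      rw [← Real.rpow_natCast, Nat.cast_sub (by omega)]
      congr 1
      rw [hNM]
      push_cast
      ring
    rw [hexp]
    calc _ ≤ 2 ^ s * N / (2 ^ s * N ^ M) := by gcongr
      _ = (1 / N) ^ (M - 1) := by
          obtain ⟨r, hr⟩ := Nat.exists_eq_add_of_le' (show 1 ≤ M by omega)
          rw [hr, Nat.add_sub_cancel, one_div_pow, pow_succ N r]
          field_simp
      _ ≤ _ := le_add_of_nonneg_left (by positivity)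

theorem law_large_bin_le {e : ℕ} (A : Finset (Key c k)) (sel : Finset (Fin l))
    (mask : Key c k → Bits l) (hk : 2 ≤ k) (he : 3 ≤ e)
    (hsk : (sel.card : ℝ) ≤ alphabetSize k / 2)
    (hμ : (A.card : ℝ) / 2 ^ sel.card ≤ alphabetSize k / 2) :
    (law c (e + 1) k l).real {T | ∃ α w, ⌊iMax k (e + 1) sel.card⌋₊ + 1 ≤
        (A.filter fun x => InBin sel mask α w x (hbar T x)).card} ≤
      (1 / alphabetSize k) ^ (((e + 1 : ℕ) : ℤ) - 3)
        + 3 ^ (c + 1) * (3 / alphabetSize k) ^ (((e + 1 : ℕ) : ℤ) - 1)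
        + (1 / alphabetSize k) ^ (alphabetSize k / 2 - 1) := by
  obtain ⟨i, hi, hiN, hbound⟩ := independent_bin_bound hk he hsk
  have hA : (A.card : ℝ) ≤ 2 ^ sel.card * Fintype.card (Bits k) / 2 := by
    rw [div_le_iff₀ (by positivity)] at hμ
    rw [alphabetSize] at hμ
    linarith
  -- N is a power of two, so it skips 6 and 7.
  have hN : 6 ≤ Fintype.card (Bits k) → 8 ≤ Fintype.card (Bits k) := by
    rw [card_bits]
    intro h6
    have : 3 ≤ k := by
      by_contra h
      interval_cases k
      omega
    exact (Nat.pow_le_pow_right two_pos this).trans' (by norm_num)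
  have hU : (0 : ℝ) < Fintype.card (Tables c (e + 1) k l) := by exact_mod_cast Fintype.card_pos
  have hcard := card_large_bin_le (e := e) A sel mask hA hN hiN
  have hz : (3 / alphabetSize k) ^ (((e + 1 : ℕ) : ℤ) - 1) = (3 / alphabetSize k) ^ e := by
    rw [← zpow_natCast]
    congr 1
    push_cast
    ring
  rw [law_real_setOf, hz, div_le_iff₀ hU]
  calc _ ≤ _ := ?_
    _ ≤ _ := hcard
    _ ≤ _ := ?_
  · refine Nat.cast_le.2 (Finset.card_le_card fun T hT => ?_)
    obtain ⟨α, w, h⟩ := (Finset.mem_filter.1 hT).2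
    exact Finset.mem_filter.2 ⟨Finset.mem_univ _, α, w, by omega⟩
  · rw [mul_comm]
    refine mul_le_mul_of_nonneg_right ?_ hU.le
    change 2 ^ sel.card * alphabetSize k / (2 ^ (i + 1) * (i + 1).factorial) +
      3 ^ (c + 1) * (3 / alphabetSize k) ^ e ≤ _
    linarith

/-- Outside the range `4 ≤ d`, `4 ≤ |Σ|` the asserted bound exceeds `1`. -/
theorem one_le_failure_bound (c : ℕ) {d k : ℕ} (h : d ≤ 3 ∨ k ≤ 1) :
    1 ≤ (1 / alphabetSize k) ^ ((d : ℤ) - 3)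
        + 3 ^ (c + 1) * (3 / alphabetSize k) ^ ((d : ℤ) - 1)
        + (1 / alphabetSize k) ^ (alphabetSize k / 2 - 1) := by
  have hN1 : 1 ≤ alphabetSize k := by
    rw [alphabetSize_eq]
    exact one_le_pow₀ (by norm_num)
  have hN0 : 0 < alphabetSize k := by linarith
  have h1 : 0 ≤ (1 / alphabetSize k) ^ ((d : ℤ) - 3) := by positivity
  have h2 : 0 ≤ 3 ^ (c + 1) * (3 / alphabetSize k) ^ ((d : ℤ) - 1) := by positivity
  have h3 : 0 ≤ (1 / alphabetSize k) ^ (alphabetSize k / 2 - 1) :=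
    Real.rpow_nonneg (by positivity) _
  have hle : 1 / alphabetSize k ≤ 1 := by rwa [div_le_one hN0]
  rcases h with h | h
  · have : 1 ≤ (1 / alphabetSize k) ^ ((d : ℤ) - 3) :=
      one_le_zpow_of_nonpos₀ (by positivity) hle (by omega)
    linarith
  · have hN2 : alphabetSize k ≤ 2 := by
      rw [alphabetSize_eq]
      calc (2 : ℝ) ^ k ≤ 2 ^ 1 := pow_le_pow_right₀ (by norm_num) h
        _ = 2 := pow_one 2
    have : 1 ≤ (1 / alphabetSize k) ^ (alphabetSize k / 2 - 1) :=
      Real.one_le_rpow_of_pos_of_le_one_of_nonpos (by positivity) hle (by linarith)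
    linarith

end Probability
end Tornado

theorem mainTheorem7 (c d k l : ℕ) [NeZero c]
    (A : Finset (Tornado.Key c k)) (sel : Finset (Fin l))
    (mask : Tornado.Key c k → Tornado.Bits l) (s : ℕ) (hs : sel.card = s)
    (hsk : (s : ℝ) ≤ Tornado.alphabetSize k / 2)
    (hμ : (A.card : ℝ) / 2 ^ s ≤ Tornado.alphabetSize k / 2) :
    (∀ T : Tornado.Tables c d k l,
      Summable fun i : {i : ℕ // Tornado.iMax k d s < (i : ℝ)} =>
        Tornado.condLayer A sel mask (i : ℕ) T) ∧
    (Tornado.law c d k l).real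
        {T | 0 < ∑' i : {i : ℕ // Tornado.iMax k d s < (i : ℝ)},
          Tornado.condLayer A sel mask (i : ℕ) T} ≤
      (1 / Tornado.alphabetSize k) ^ ((d : ℤ) - 3)
        + 3 ^ (c + 1) * (3 / Tornado.alphabetSize k) ^ ((d : ℤ) - 1)
        + (1 / Tornado.alphabetSize k) ^ (Tornado.alphabetSize k / 2 - 1) := by
  subst hs
  refine ⟨fun T => ?_, ?_⟩
  · refine summable_of_hasFiniteSupport ?_
    refine Set.Finite.subset ((Set.finite_Iic A.card).preimage Subtype.val_injective.injOn) ?_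
    intro i hi
    by_contra hlt
    exact hi (Tornado.condLayer_eq_zero_of_card_lt A sel mask (not_le.1 hlt) T)
  by_cases htriv : d ≤ 3 ∨ k ≤ 1
  · exact measureReal_le_one.trans (Tornado.one_le_failure_bound c htriv)
  push Not at htriv
  obtain ⟨e, rfl⟩ := Nat.exists_eq_add_of_le' (show 1 ≤ d by omega)
  refine le_trans (measureReal_mono ?_)
    (Tornado.law_large_bin_le A sel mask (by omega) (by omega) hsk hμ)
  intro T hT
  obtain ⟨⟨i, hi⟩, hpos⟩ : ∃ i : {i : ℕ // Tornado.iMax k (e + 1) sel.card < (i : ℝ)},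
      0 < Tornado.condLayer A sel mask (i : ℕ) T := by
    by_contra! hc
    exact (tsum_nonpos hc).not_gt hT
  obtain ⟨T', hT', hlayer⟩ := Tornado.exists_layer_pos_of_condLayer_pos A sel mask i T hpos
  obtain ⟨α, w, h⟩ := Tornado.exists_large_bin_of_layer_pos A sel mask i T' hlayer
  rw [hT'] at h
  -- Nonnegativity makes the natural floor a true floor, so i > i_max yields i ≥ ⌊i_max⌋ + 1.
  have h1 : 1 ≤ Tornado.iMax k (e + 1) sel.card := by
    obtain ⟨f, rfl⟩ := Nat.exists_eq_add_of_le' (show 1 ≤ e by omega)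
    exact Tornado.one_le_iMax (by omega) (by omega)
  have hfloor : ⌊Tornado.iMax k (e + 1) sel.card⌋₊ < i := (Nat.floor_lt (by linarith)).2 hi
  refine ⟨α, w, ?_⟩
  convert (show _ ≤ _ from hfloor).trans h
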